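/- Let $g\ge 0$, $\eta\ge 0$ and, for $k\in\mathbb R$, $S(k)=\frac{k-ig}{k+ig}$, $T(k)=\frac{k}{k+i\eta}$, $R(k)=\frac{-i\eta}{k+i\eta}$. Let $\mathcal L=\bigoplus_{\alpha=\pm}L^2(\mathbb R)$; elements of the Hilbert tensor power $\mathcal L^{\otimes n}$ are square integrable functions $\varphi_{\alpha_1\ldots\alpha_n}(p_1,\ldots,p_n)$ with $\alpha_i=\pm$, $p_i\in\mathbb R$, with the scalar product $\sum_{\alpha_1,\ldots,\alpha_n}\int\overline{\varphi}\,\psi\,dp_1\cdots dp_n$. Let $\mathcal H^{(0)}=\mathbb C$ and, for $n\ge 1$, let $\mathcal H^{(n)}\subset\mathcal L^{\otimes n}$ be the closed subspace of the $\varphi$ such that, almost everywhere, $$\varphi_{\alpha_1\ldots\alpha_n}(p_1,\ldots,p_n)=T(\alpha_np_n)\,\varphi_{\alpha_1\ldots\alpha_{n-1},-\alpha_n}(p_1,\ldots,p_n)+R(\alpha_np_n)\,\varphi_{\alpha_1\ldots\alpha_n}(p_1,\ldots,p_{n-1},-p_n)$$ and, for $1\le i\le n-1$, $$\varphi_{\ldots\alpha_i\alpha_{i+1}\ldots}(\ldots,p_i,p_{i+1},\ldots)=S(\alpha_ip_i-\alpha_{i+1}p_{i+1})\,\varphi_{\ldots\alpha_{i+1}\alpha_i\ldots}(\ldots,p_{i+1},p_i,\ldots).$$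 Let $P^{(n)}$ be the orthogonal projector of $\mathcal L^{\otimes n}$ onto $\mathcal H^{(n)}$, let $\mathcal F=\bigoplus_{n\ge0}\mathcal H^{(n)}$ (Hilbert sum) be the Fock space and $\Omega=(1,0,0,\ldots)$. For $\mathfrak f\in\mathcal L$ the creation operator $a^\dagger(\mathfrak f)$ is defined on the sequences $\varphi\in\mathcal F$ with finitely many nonzero components by $[a^\dagger(\mathfrak f)\varphi]^{(0)}=0$ and $[a^\dagger(\mathfrak f)\varphi]^{(n+1)}=\sqrt{n+1}\,P^{(n+1)}(\mathfrak f\otimes\varphi^{(n)})$; for a function $\mathfrak h$ on $\mathbb R$, $a^\dagger_\alpha(\mathfrak h)$ is $a^\dagger(\mathfrak f)$ with $\mathfrak f_\alpha=\mathfrak h$, $\mathfrak f_{-\alpha}=0$. Write $\mathbb R^{\alpha}=\{p:\alpha p>0\}$, and $f\succ h$ if $|x|>|y|$ for all $x\in\operatorname{supp}f$, $y\in\operatorname{supp}h$. Let $\mathfrak H_n$ consist of the families of signs $\alpha_1,\ldots,\alpha_n$ and functions $\mathfrak h_i\in C_0^\infty(\mathbb R^{\alpha_i})$ with $\mathfrak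 h_i\succ\mathfrak h_j$ for $i<j$, and $\mathfrak G_m$ of the families of signs $\beta_1,\ldots,\beta_m$ and functions $\mathfrak g_i\in C_0^\infty(\mathbb R^{-\beta_i})$ with $\mathfrak g_j\succ\mathfrak g_i$ for $i<j$. Let $\mathcal F^{out}$ be the linear span of $\Omega$ and all the vectors $a^\dagger_{\alpha_1}(\mathfrak h_1)\cdots a^\dagger_{\alpha_n}(\mathfrak h_n)\Omega$ with $n\ge1$ and $(\alpha_i,\mathfrak h_i)\in\mathfrak H_n$, and $\mathcal F^{in}$ the linear span of $\Omega$ and all the vectors $a^\dagger_{\beta_1}(\mathfrak g_1)\cdots a^\dagger_{\beta_m}(\mathfrak g_m)\Omega$ with $m\ge1$ and $(\beta_i,\mathfrak g_i)\in\mathfrak G_m$. Then there is exactly one linear map $\mathbf S:\mathcal F^{out}\to\mathcal F^{in}$ such that $\mathbf S\Omega=\Omega$ and, for all $n\ge 1$ and all families in $\mathfrak H_n$, $$\mathbf S\,a^\dagger_{\alpha_1}(\mathfrak h_1)\cdots a^\dagger_{\alpha_n}(\mathfrak h_n)\Omega=a^\dagger_{\alpha_n}(\hat{\mathfrak h}_n)\cdots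 a^\dagger_{\alpha_1}(\hat{\mathfrak h}_1)\Omega,\qquad \hat{\mathfrak h}(p)=\mathfrak h(-p).$$ The map $\mathbf S$ is invertible, i.e. a bijection of $\mathcal F^{out}$ onto $\mathcal F^{in}$; $\mathbf S$ and $\mathbf S^{-1}:\mathcal F^{in}\to\mathcal F^{out}$ each have a unique extension to a bounded linear operator on $\mathcal F$, and these extensions are unitary operators on $\mathcal F$, inverse to each other. -/

import Mathlib

open MeasureTheory
open scoped ENNReal

noncomputable section

namespace ImpurityNLS

/-! ### Scattering data -/

/-- The label `α = ±` of a half-line: `true` is `+`, `false` is `-`, and `!α` is `-α`. -/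
abbrev Side := Bool

/-- The sign `α = ±1` as a real number. -/
def sgn (α : Side) : ℝ := if α then 1 else -1

/-- The two-body amplitude `S(k) = (k - i g) / (k + i g)`. -/
def bulkS (g k : ℝ) : ℂ := ((k : ℂ) - Complex.I * g) / ((k : ℂ) + Complex.I * g)

/-- The transmission coefficient `T(k) = k / (k + i η)`. -/
def transT (η k : ℝ) : ℂ := (k : ℂ) / ((k : ℂ) + Complex.I * η)

/-- The reflection coefficient `R(k) = - i η / (k + i η)`. -/
def reflR (η k : ℝ) : ℂ := (-(Complex.I * η)) / ((k : ℂ) + Complex.I * η)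

/-! ### The space `⨁_{α = ±} L²(ℝ)` and its tensor powers -/

/-- A pair `(α, p)` of a side and a momentum. -/
abbrev Label := Side × ℝ

/-- The number `α p`. -/
def rapidity (x : Label) : ℝ := sgn x.1 * x.2

/-- `(α, p) ↦ (-α, p)`. -/
def flipSide (x : Label) : Label := (!x.1, x.2)

/-- `(α, p) ↦ (α, -p)`. -/
def flipMomentum (x : Label) : Label := (x.1, -x.2)

/-- Counting measure in `α` times Lebesgue measure in `p`, that is `∑_{α = ±} ∫ dp`. -/
def labelMeasure : Measure Label := (Measure.count : Measure Side).prod (volume : Measure ℝ)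

/-- `∑_{α₁, …, αₙ} ∫ dp₁ ⋯ dpₙ`. -/
def tensorMeasure (n : ℕ) : Measure (Fin n → Label) := Measure.pi fun _ => labelMeasure

/-- The one-particle space `⨁_{α = ±} L²(ℝ)`, a pair `(φ₊, φ₋)` being regarded as the function
`(α, p) ↦ φ_α(p)`. -/
abbrev OneParticle := Lp ℂ 2 labelMeasure

/-- The `n`-fold Hilbert tensor power of the one-particle space, whose elements are the functions
`φ_{α₁ … αₙ}(p₁, …, pₙ)` that are square integrable for `∑_{α₁, …, αₙ} ∫ dp₁ ⋯ dpₙ`. -/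
abbrev TensorPower (n : ℕ) := Lp ℂ 2 (tensorMeasure n)

/-! ### Auxiliary facts on changes of variables and on multiplication by bounded functions -/

instance : SigmaFinite labelMeasure := by unfold labelMeasure; infer_instance

instance (n : ℕ) : SigmaFinite (tensorMeasure n) := by unfold tensorMeasure; infer_instance

theorem measurePreserving_flipSide : MeasurePreserving flipSide labelMeasure labelMeasure := by
  have h : MeasurePreserving (fun b : Side => !b) Measure.count Measure.count := by
    refine ⟨measurable_of_finite _, ?_⟩
    ext s hs
    rw [Measure.map_apply (measurable_of_finite _) hs, Measure.count_apply hs,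
      Measure.count_apply (measurable_of_finite _ hs),
      ← Bool.not_injective.encard_image ((fun b : Side => !b) ⁻¹' s),
      Set.image_preimage_eq s Bool.involutive_not.surjective]
  exact h.prod (MeasurePreserving.id volume)

theorem measurePreserving_flipMomentum :
    MeasurePreserving flipMomentum labelMeasure labelMeasure :=
  (MeasurePreserving.id _).prod (Measure.measurePreserving_neg volume)

theorem measurePreserving_update {n : ℕ} (i : Fin n) {f : Label → Label}
    (hf : MeasurePreserving f labelMeasure labelMeasure) :
    MeasurePreserving (fun x : Fin n → Label => Function.update x i (f (x i)))
      (tensorMeasure n) (tensorMeasure n) := by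
  have h := measurePreserving_pi (fun _ : Fin n => labelMeasure) (fun _ : Fin n => labelMeasure)
    (f := fun j => if j = i then f else id) (by
      intro j
      by_cases hj : j = i
      · simpa [hj] using hf
      · simpa [hj] using MeasurePreserving.id labelMeasure)
  have he : (fun x : Fin n → Label => Function.update x i (f (x i))) =
      fun x j => (if j = i then f else id) (x j) := by
    ext1 x
    ext1 j
    by_cases hj : j = i
    · subst hj; simp
    · simp [hj]
  rw [he]
  exact h

theorem measurePreserving_swap {n : ℕ} (i j : Fin n) :
    MeasurePreserving (fun x : Fin n → Label => x ∘ Equiv.swap i j)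
      (tensorMeasure n) (tensorMeasure n) := by
  have h := measurePreserving_piCongrLeft (fun _ : Fin n => labelMeasure) (Equiv.swap i j)
  have he : (fun x : Fin n → Label => x ∘ Equiv.swap i j) =
      MeasurableEquiv.piCongrLeft (fun _ : Fin n => Label) (Equiv.swap i j) := by
    ext1 x
    ext1 k
    have := Equiv.piCongrLeft_apply_apply (fun _ : Fin n => Label) (Equiv.swap i j) x
      (Equiv.swap i j k)
    rw [Equiv.swap_apply_self] at this
    exact this.symm
  rw [he]
  exact h

theorem measurable_rapidity : Measurable rapidity := by
  unfold rapidity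
  exact ((measurable_of_finite sgn).comp measurable_fst).mul measurable_snd

theorem measurable_rapidity_apply {n : ℕ} (i : Fin n) :
    Measurable (fun x : Fin n → Label => rapidity (x i)) :=
  measurable_rapidity.comp (measurable_pi_apply i)

theorem measurable_bulkS (g : ℝ) : Measurable (bulkS g) := by unfold bulkS; fun_prop

theorem measurable_transT (η : ℝ) : Measurable (transT η) := by unfold transT; fun_prop

theorem measurable_reflR (η : ℝ) : Measurable (reflR η) := by unfold reflR; fun_prop

theorem norm_add_I_mul (k c : ℝ) : ‖(k : ℂ) + Complex.I * c‖ = √(k ^ 2 + c ^ 2) := by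
  rw [mul_comm, Complex.norm_add_mul_I]

theorem norm_bulkS_le (g k : ℝ) : ‖bulkS g k‖ ≤ 1 := by
  have h : ‖(k : ℂ) - Complex.I * g‖ = √(k ^ 2 + g ^ 2) := by
    have := norm_add_I_mul k (-g)
    push_cast at this
    rw [← neg_sq g, ← this]
    congr 1
    ring
  unfold bulkS
  rw [norm_div, h, norm_add_I_mul]
  exact div_self_le_one _

theorem norm_transT_le (η k : ℝ) : ‖transT η k‖ ≤ 1 := by
  unfold transT
  rw [norm_div, norm_add_I_mul]
  refine div_le_one_of_le₀ ?_ (Real.sqrt_nonneg _)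
  rw [Complex.norm_real]
  exact Real.abs_le_sqrt (by nlinarith [sq_nonneg η])

theorem norm_reflR_le (η k : ℝ) : ‖reflR η k‖ ≤ 1 := by
  unfold reflR
  rw [norm_div, norm_add_I_mul]
  refine div_le_one_of_le₀ ?_ (Real.sqrt_nonneg _)
  rw [norm_neg, norm_mul, Complex.norm_I, one_mul, Complex.norm_real]
  exact Real.abs_le_sqrt (by nlinarith [sq_nonneg k])

section WeightedComp

variable {Y : Type*} [MeasurableSpace Y] {ν : Measure Y}

theorem memLp_weightedComp {m : Y → ℂ} (hm : Measurable m) (hb : ∀ y, ‖m y‖ ≤ 1) {e : Y → Y}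
    (he : MeasurePreserving e ν ν) (φ : Lp ℂ 2 ν) : MemLp (fun y => m y * φ (e y)) 2 ν := by
  have h : MemLp (fun y => φ (e y)) 2 ν := (Lp.memLp φ).comp_measurePreserving he
  refine h.of_le (hm.aestronglyMeasurable.mul h.1) (Filter.Eventually.of_forall fun y => ?_)
  rw [norm_mul]
  exact mul_le_of_le_one_left (norm_nonneg _) (hb y)

/-- The operator `φ ↦ m · (φ ∘ e)` on `L²`, for `|m| ≤ 1` and `e` measure preserving. -/
def weightedComp (m : Y → ℂ) (hm : Measurable m) (hb : ∀ y, ‖m y‖ ≤ 1) (e : Y → Y)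
    (he : MeasurePreserving e ν ν) : Lp ℂ 2 ν →L[ℂ] Lp ℂ 2 ν :=
  LinearMap.mkContinuous
    { toFun := fun φ => (memLp_weightedComp hm hb he φ).toLp _
      map_add' := by
        intro φ ψ
        rw [← MemLp.toLp_add]
        refine MemLp.toLp_congr _ _ ?_
        filter_upwards [he.quasiMeasurePreserving.ae (Lp.coeFn_add φ ψ)] with y hy
        simp only [Pi.add_apply] at hy ⊢
        rw [hy]; ring
      map_smul' := by
        intro c φ
        simp only [RingHom.id_apply]
        rw [← MemLp.toLp_const_smul]
        refine MemLp.toLp_congr _ _ ?_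
        filter_upwards [he.quasiMeasurePreserving.ae (Lp.coeFn_smul c φ)] with y hy
        simp only [Pi.smul_apply, smul_eq_mul] at hy ⊢
        rw [hy]; ring }
    1 (by
      intro φ
      rw [one_mul, ← Lp.norm_compMeasurePreserving φ he]
      refine Lp.norm_le_norm_of_ae_le ?_
      filter_upwards [(memLp_weightedComp hm hb he φ).coeFn_toLp,
        Lp.coeFn_compMeasurePreserving φ he] with y h1 h2
      simp only [LinearMap.coe_mk, AddHom.coe_mk]
      rw [h1, h2, norm_mul]
      exact mul_le_of_le_one_left (norm_nonneg _) (hb y))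

theorem coeFn_weightedComp (m : Y → ℂ) (hm : Measurable m) (hb : ∀ y, ‖m y‖ ≤ 1) (e : Y → Y)
    (he : MeasurePreserving e ν ν) (φ : Lp ℂ 2 ν) :
    weightedComp m hm hb e he φ =ᵐ[ν] fun y => m y * φ (e y) :=
  (memLp_weightedComp hm hb he φ).coeFn_toLp

end WeightedComp

/-! ### The `n`-particle spaces -/

/-- The reflection-transmission property at the index `i`:
`φ_{… α_i …}(…, p_i, …) = T(α_i p_i) φ_{… -α_i …}(…, p_i, …)
  + R(α_i p_i) φ_{… α_i …}(…, -p_i, …)` almost everywhere. -/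
def IsReflectionInvariant (η : ℝ) {n : ℕ} (i : Fin n) (φ : TensorPower n) : Prop :=
  ∀ᵐ x ∂(tensorMeasure n),
    φ x = transT η (rapidity (x i)) * φ (Function.update x i (flipSide (x i)))
      + reflR η (rapidity (x i)) * φ (Function.update x i (flipMomentum (x i)))

/-- The exchange property at the indices `i`, `j`:
`φ_{… α_i … α_j …}(…, p_i, …, p_j, …)
  = S(α_i p_i - α_j p_j) φ_{… α_j … α_i …}(…, p_j, …, p_i, …)` almost everywhere. -/
def IsExchangeInvariant (g : ℝ) {n : ℕ} (i j : Fin n) (φ : TensorPower n) : Prop :=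
  ∀ᵐ x ∂(tensorMeasure n),
    φ x = bulkS g (rapidity (x i) - rapidity (x j)) * φ (x ∘ Equiv.swap i j)

/-- The operator whose fixed points are the reflection invariant functions. -/
def reflectionOp (η : ℝ) {n : ℕ} (i : Fin n) : TensorPower n →L[ℂ] TensorPower n :=
  weightedComp (fun x => transT η (rapidity (x i)))
      ((measurable_transT η).comp (measurable_rapidity_apply i))
      (fun _ => norm_transT_le _ _) _ (measurePreserving_update i measurePreserving_flipSide)
    + weightedComp (fun x => reflR η (rapidity (x i)))
      ((measurable_reflR η).comp (measurable_rapidity_apply i))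
      (fun _ => norm_reflR_le _ _) _ (measurePreserving_update i measurePreserving_flipMomentum)

/-- The operator whose fixed points are the exchange invariant functions. -/
def exchangeOp (g : ℝ) {n : ℕ} (i j : Fin n) : TensorPower n →L[ℂ] TensorPower n :=
  weightedComp (fun x => bulkS g (rapidity (x i) - rapidity (x j)))
    ((measurable_bulkS g).comp ((measurable_rapidity_apply i).sub
      (measurable_rapidity_apply j)))
    (fun _ => norm_bulkS_le _ _) _ (measurePreserving_swap i j)

theorem isReflectionInvariant_iff (η : ℝ) {n : ℕ} (i : Fin n) (φ : TensorPower n) :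
    IsReflectionInvariant η i φ ↔ reflectionOp η i φ = φ := by
  have h : reflectionOp η i φ =ᵐ[tensorMeasure n] fun x =>
      transT η (rapidity (x i)) * φ (Function.update x i (flipSide (x i)))
        + reflR η (rapidity (x i)) * φ (Function.update x i (flipMomentum (x i))) := by
    refine (Lp.coeFn_add _ _).trans ?_
    exact (coeFn_weightedComp _ _ _ _ _ φ).add (coeFn_weightedComp _ _ _ _ _ φ)
  rw [Lp.ext_iff]
  constructor
  · intro H
    filter_upwards [h, H] with x h1 h2
    rw [h1, h2]
  · intro H
    unfold IsReflectionInvariant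
    filter_upwards [h, H] with x h1 h2
    rw [← h1, h2]

theorem isExchangeInvariant_iff (g : ℝ) {n : ℕ} (i j : Fin n) (φ : TensorPower n) :
    IsExchangeInvariant g i j φ ↔ exchangeOp g i j φ = φ := by
  have h : exchangeOp g i j φ =ᵐ[tensorMeasure n] fun x =>
      bulkS g (rapidity (x i) - rapidity (x j)) * φ (x ∘ Equiv.swap i j) :=
    coeFn_weightedComp _ _ _ _ _ φ
  rw [Lp.ext_iff]
  constructor
  · intro H
    filter_upwards [h, H] with x h1 h2
    rw [h1, h2]
  · intro H
    unfold IsExchangeInvariant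
    filter_upwards [h, H] with x h1 h2
    rw [← h1, h2]

/-- The `n`-particle space: the functions in the `n`-th tensor power with the
reflection-transmission property at the last index and the exchange property at all pairs of
consecutive indices. For `n = 0` no condition remains, and the space is `L²` of a one-point space
of mass one, that is `ℂ`. -/
def nParticle (g η : ℝ) (n : ℕ) : Submodule ℂ (TensorPower n) where
  carrier := {φ | (∀ i : Fin n, (i : ℕ) + 1 = n → IsReflectionInvariant η i φ) ∧
    ∀ i j : Fin n, (i : ℕ) + 1 = j → IsExchangeInvariant g i j φ}
  add_mem' := by
    simp only [Set.mem_ofPred_eq, isReflectionInvariant_iff, isExchangeInvariant_iff]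
    intro φ ψ hφ hψ
    exact ⟨fun i hi => by rw [map_add, hφ.1 i hi, hψ.1 i hi],
      fun i j hij => by rw [map_add, hφ.2 i j hij, hψ.2 i j hij]⟩
  zero_mem' := by
    simp only [Set.mem_ofPred_eq, isReflectionInvariant_iff, isExchangeInvariant_iff]
    exact ⟨fun i _ => map_zero _, fun i j _ => map_zero _⟩
  smul_mem' := by
    simp only [Set.mem_ofPred_eq, isReflectionInvariant_iff, isExchangeInvariant_iff]
    intro c φ hφ
    exact ⟨fun i hi => by rw [map_smul, hφ.1 i hi],
      fun i j hij => by rw [map_smul, hφ.2 i j hij]⟩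

theorem isClosed_nParticle (g η : ℝ) (n : ℕ) :
    IsClosed (nParticle g η n : Set (TensorPower n)) := by
  have h : (nParticle g η n : Set (TensorPower n)) =
      {φ | (∀ i : Fin n, (i : ℕ) + 1 = n → reflectionOp η i φ = φ) ∧
        ∀ i j : Fin n, (i : ℕ) + 1 = j → exchangeOp g i j φ = φ} := by
    ext φ
    simp only [← isReflectionInvariant_iff, ← isExchangeInvariant_iff]
    rfl
  rw [h]
  simp only [Set.ofPred_and, Set.ofPred_forall]
  refine IsClosed.inter ?_ ?_
  · exact isClosed_iInter fun i => isClosed_iInter fun _ =>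
      isClosed_eq (reflectionOp η i).continuous continuous_id
  · exact isClosed_iInter fun i => isClosed_iInter fun j => isClosed_iInter fun _ =>
      isClosed_eq (exchangeOp g i j).continuous continuous_id

instance (g η : ℝ) (n : ℕ) : CompleteSpace (nParticle g η n) :=
  (isClosed_nParticle g η n).completeSpace_coe

/-- The orthogonal projector `P⁽ⁿ⁾` of the `n`-th tensor power onto the `n`-particle space. -/
def projP (g η : ℝ) (n : ℕ) : TensorPower n →L[ℂ] nParticle g η n :=
  (nParticle g η n).orthogonalProjectionOnto

/-! ### The Fock space -/

/-- The Fock space, the Hilbert sum of the `n`-particle spaces. -/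
abbrev Fock (g η : ℝ) := lp (fun n : ℕ => nParticle g η n) 2

/-- The finite particle space: the sequences with `φ⁽ⁿ⁾ = 0` for `n` large enough. -/
def finiteParticle (g η : ℝ) : Submodule ℂ (Fock g η) where
  carrier := {φ | ∃ N : ℕ, ∀ n, N ≤ n → φ n = 0}
  add_mem' := by
    rintro φ ψ ⟨N, hN⟩ ⟨M, hM⟩
    refine ⟨max N M, fun n hn => ?_⟩
    rw [lp.coeFn_add, Pi.add_apply, hN n (le_of_max_le_left hn), hM n (le_of_max_le_right hn),
      add_zero]
  zero_mem' := ⟨0, fun n _ => by simp⟩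
  smul_mem' := by
    rintro c φ ⟨N, hN⟩
    refine ⟨N, fun n hn => ?_⟩
    rw [lp.coeFn_smul, Pi.smul_apply, hN n hn, smul_zero]

theorem memLp_one_zero : MemLp (fun _ : Fin 0 → Label => (1 : ℂ)) 2 (tensorMeasure 0) := by
  have : IsFiniteMeasure (tensorMeasure 0) := by
    unfold tensorMeasure; rw [Measure.pi_of_empty]; infer_instance
  exact memLp_const 1

/-- The vector `1` of the zero-particle space `ℂ`. -/
def vacuumZero (g η : ℝ) : nParticle g η 0 :=
  ⟨memLp_one_zero.toLp _, fun i => i.elim0, fun i => i.elim0⟩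

/-- The vacuum `Ω = (1, 0, 0, …)`. -/
def vacuum (g η : ℝ) : finiteParticle g η :=
  ⟨lp.single (E := fun n : ℕ => nParticle g η n) 2 0 (vacuumZero g η), 1, fun _ hn =>
    lp.single_apply_ne (E := fun n : ℕ => nParticle g η n) 2 0 (vacuumZero g η) (Nat.pos_iff_ne_zero.1 hn)⟩

/-! ### Creation operators -/

theorem memLp_tensor (f : OneParticle) {n : ℕ} (φ : TensorPower n) :
    MemLp (fun x : Fin (n + 1) → Label => f (x 0) * φ (fun i => x i.succ)) 2
      (tensorMeasure (n + 1)) := by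
  have h : MemLp (fun z : Label × (Fin n → Label) => f z.1 * φ z.2) 2
      (labelMeasure.prod (tensorMeasure n)) := by
    have hm : AEStronglyMeasurable (fun z : Label × (Fin n → Label) => f z.1 * φ z.2)
        (labelMeasure.prod (tensorMeasure n)) :=
      (Lp.aestronglyMeasurable f).comp_fst.mul (Lp.aestronglyMeasurable φ).comp_snd
    rw [memLp_two_iff_integrable_sq_norm hm]
    have := ((memLp_two_iff_integrable_sq_norm (Lp.aestronglyMeasurable f)).1 (Lp.memLp f)).mul_prod
      ((memLp_two_iff_integrable_sq_norm (Lp.aestronglyMeasurable φ)).1 (Lp.memLp φ))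
    refine this.congr (Filter.Eventually.of_forall fun z => ?_)
    simp only [norm_mul, mul_pow]
  exact h.comp_measurePreserving
    (measurePreserving_piFinSuccAbove (fun _ : Fin (n + 1) => labelMeasure) 0)

theorem quasiMeasurePreserving_tail (n : ℕ) :
    Measure.QuasiMeasurePreserving (fun (x : Fin (n + 1) → Label) (i : Fin n) => x i.succ)
      (tensorMeasure (n + 1)) (tensorMeasure n) :=
  Measure.quasiMeasurePreserving_snd.comp
    (measurePreserving_piFinSuccAbove
      (fun _ : Fin (n + 1) => labelMeasure) 0).quasiMeasurePreserving

/-- `φ ↦ f ⊗ φ`. -/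
def tensorLeft (f : OneParticle) (n : ℕ) : TensorPower n →ₗ[ℂ] TensorPower (n + 1) where
  toFun φ := (memLp_tensor f φ).toLp _
  map_add' φ ψ := by
    rw [← MemLp.toLp_add]
    refine MemLp.toLp_congr _ _ ?_
    filter_upwards [(quasiMeasurePreserving_tail n).ae (Lp.coeFn_add φ ψ)] with x hx
    simp only [Pi.add_apply] at hx ⊢
    rw [hx]; ring
  map_smul' c φ := by
    simp only [RingHom.id_apply]
    rw [← MemLp.toLp_const_smul]
    refine MemLp.toLp_congr _ _ ?_
    filter_upwards [(quasiMeasurePreserving_tail n).ae (Lp.coeFn_smul c φ)] with x hx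
    simp only [Pi.smul_apply, smul_eq_mul] at hx ⊢
    rw [hx]; ring

/-- `φ⁽ⁿ⁾ ↦ √(n + 1) P⁽ⁿ⁺¹⁾ (f ⊗ φ⁽ⁿ⁾)`. -/
def creationLevel (g η : ℝ) (f : OneParticle) (n : ℕ) :
    nParticle g η n →ₗ[ℂ] nParticle g η (n + 1) :=
  (√((n : ℝ) + 1) : ℂ) •
    ((projP g η (n + 1)).toLinearMap ∘ₗ tensorLeft f n ∘ₗ (nParticle g η n).subtype)

/-- The components of `a†(f) φ`. -/
def creationSeq (g η : ℝ) (f : OneParticle) (φ : Fock g η) : (n : ℕ) → nParticle g η n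
  | 0 => 0
  | n + 1 => creationLevel g η f n (φ n)

theorem creationSeq_eq_zero {g η : ℝ} (f : OneParticle) {φ : Fock g η} {N : ℕ}
    (hN : ∀ n, N ≤ n → φ n = 0) : ∀ n, N + 1 ≤ n → creationSeq g η f φ n = 0
  | 0, h => by lia
  | n + 1, h => by
    rw [creationSeq, hN n (by lia), map_zero]

theorem memℓp_creationSeq {g η : ℝ} (f : OneParticle) (φ : finiteParticle g η) :
    Memℓp (creationSeq g η f φ) 2 := by
  obtain ⟨N, hN⟩ := φ.2
  refine (memℓp_zero ((Set.finite_lt_nat (N + 1)).subset fun n hn => ?_)).of_exponent_ge zero_le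
  by_contra h
  exact hn (creationSeq_eq_zero f hN n (not_lt.1 h))

/-- The creation operator `a†(f)` on the finite particle space:
`[a†(f) φ]⁽⁰⁾ = 0` and `[a†(f) φ]⁽ⁿ⁺¹⁾ = √(n + 1) P⁽ⁿ⁺¹⁾ (f ⊗ φ⁽ⁿ⁾)`. -/
def creation (g η : ℝ) (f : OneParticle) : Module.End ℂ (finiteParticle g η) where
  toFun φ := ⟨⟨creationSeq g η f φ, memℓp_creationSeq f φ⟩, by
    obtain ⟨N, hN⟩ := φ.2
    exact ⟨N + 1, creationSeq_eq_zero f hN⟩⟩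
  map_add' φ ψ := by
    refine Subtype.ext (lp.ext (funext fun n => ?_))
    cases n with
    | zero => exact (add_zero (0 : nParticle g η 0)).symm
    | succ n => exact map_add (creationLevel g η f n) _ _
  map_smul' c φ := by
    refine Subtype.ext (lp.ext (funext fun n => ?_))
    cases n with
    | zero => exact (smul_zero (A := nParticle g η 0) c).symm
    | succ n => exact map_smul (creationLevel g η f n) c _

/-! ### Smearing functions -/

/-- `ℝ^α`: the open half-line `{p | 0 < α p}`. -/
def halfLine (α : Side) : TopologicalSpace.Opens ℝ :=
  ⟨{p | 0 < sgn α * p}, isOpen_lt continuous_const (by fun_prop)⟩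

/-- `C₀^∞(ℝ^α)`: the smooth complex functions with compact support in `ℝ^α`. -/
abbrev HalfLineTest (α : Side) := TestFunction (halfLine α) ℂ (⊤ : ℕ∞)

theorem memLp_component (α : Side) {Ω : TopologicalSpace.Opens ℝ}
    (h : TestFunction Ω ℂ (⊤ : ℕ∞)) :
    MemLp (fun x : Label => if x.1 = α then h x.2 else 0) 2 labelMeasure := by
  have hh : MemLp (fun p : ℝ => h p) 2 volume :=
    h.continuous.memLp_of_hasCompactSupport h.hasCompactSupport
  have hm : Measurable (fun x : Label => if x.1 = α then h x.2 else 0) :=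
    Measurable.ite (measurable_fst (measurableSet_singleton α))
      (h.continuous.measurable.comp measurable_snd) measurable_const
  rw [memLp_two_iff_integrable_sq_norm hm.aestronglyMeasurable]
  have h1 := (memLp_two_iff_integrable_sq_norm
    h.continuous.aestronglyMeasurable).1 hh
  have h2 : Integrable (fun b : Side => if b = α then (1 : ℝ) else 0) Measure.count :=
    Integrable.of_finite
  refine (h2.mul_prod h1).congr (Filter.Eventually.of_forall fun x => ?_)
  by_cases hx : x.1 = α <;> simp [hx]

/-- The element of `⨁_{α = ±} L²(ℝ)` with `α`-component `h` and other component `0`. -/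
def component (α : Side) {Ω : TopologicalSpace.Opens ℝ} (h : TestFunction Ω ℂ (⊤ : ℕ∞)) :
    OneParticle :=
  (memLp_component α h).toLp _

/-- The creation operator `a†_α(h)`. -/
def creationAt (g η : ℝ) (α : Side) {Ω : TopologicalSpace.Opens ℝ}
    (h : TestFunction Ω ℂ (⊤ : ℕ∞)) : Module.End ℂ (finiteParticle g η) :=
  creation g η (component α h)

/-- The ordering `f ≻ h`: `|x| > |y|` for all `x ∈ supp f` and `y ∈ supp h`. -/
def Succeeds (f h : ℝ → ℂ) : Prop := ∀ x ∈ tsupport f, ∀ y ∈ tsupport h, |y| < |x|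

/-- The families `ℌ_n`: signs `α₁, …, αₙ` and functions `h_i ∈ C₀^∞(ℝ^{α_i})` with
`h₁ ≻ ⋯ ≻ hₙ`. -/
structure OutFamily (n : ℕ) where
  /-- the signs -/
  side : Fin n → Side
  /-- the functions -/
  fn : ∀ i, HalfLineTest (side i)
  /-- the ordering -/
  ordered : ∀ i j, i < j → Succeeds (fn i) (fn j)

/-- The families `𝔊_m`: signs `β₁, …, βₘ` and functions `g_i ∈ C₀^∞(ℝ^{-β_i})` with
`gₘ ≻ ⋯ ≻ g₁`. -/
structure InFamily (m : ℕ) where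
  /-- the signs -/
  side : Fin m → Side
  /-- the functions -/
  fn : ∀ i, HalfLineTest (!(side i))
  /-- the ordering -/
  ordered : ∀ i j, i < j → Succeeds (fn j) (fn i)

/-- The vector `a†_{α₁}(h₁) ⋯ a†_{αₙ}(hₙ) Ω`; for `n = 0` it is `Ω`. -/
def OutFamily.state (g η : ℝ) {n : ℕ} (h : OutFamily n) : Fock g η :=
  ((List.ofFn fun i => creationAt g η (h.side i) (h.fn i)).prod (vacuum g η) :
    finiteParticle g η)

/-- The vector `a†_{β₁}(g₁) ⋯ a†_{βₘ}(gₘ) Ω`; for `m = 0` it is `Ω`. -/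
def InFamily.state (g η : ℝ) {m : ℕ} (f : InFamily m) : Fock g η :=
  ((List.ofFn fun i => creationAt g η (f.side i) (f.fn i)).prod (vacuum g η) :
    finiteParticle g η)

/-- The space `F^out`, the span of `Ω` and of the vectors `a†_{α₁}(h₁) ⋯ a†_{αₙ}(hₙ) Ω`
with `(h_i) ∈ ℌ_n`. -/
def outSpace (g η : ℝ) : Submodule ℂ (Fock g η) :=
  Submodule.span ℂ (insert (vacuum g η : Fock g η)
    {v | ∃ (n : ℕ) (h : OutFamily n), v = h.state g η})

/-- The space `F^in`, the span of `Ω` and of the vectors `a†_{β₁}(g₁) ⋯ a†_{βₘ}(gₘ) Ω`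
with `(g_i) ∈ 𝔊_m`. -/
def inSpace (g η : ℝ) : Submodule ℂ (Fock g η) :=
  Submodule.span ℂ (insert (vacuum g η : Fock g η)
    {v | ∃ (m : ℕ) (f : InFamily m), v = f.state g η})

theorem tsupport_comp_neg (h : ℝ → ℂ) : tsupport (fun p => h (-p)) = Neg.neg ⁻¹' tsupport h :=
  tsupport_comp_eq_preimage h (Homeomorph.neg ℝ)

/-- The reflected function `ĥ(p) = h(-p)`. -/
def hat {α : Side} (h : HalfLineTest α) : HalfLineTest (!α) where
  toFun p := h (-p)
  contDiff' := h.contDiff.comp contDiff_neg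
  hasCompactSupport' := h.hasCompactSupport.comp_homeomorph (Homeomorph.neg ℝ)
  tsupport_subset' := by
    rw [tsupport_comp_neg]
    intro p hp
    have := h.tsupport_subset hp
    change 0 < sgn α * -p at this
    change 0 < sgn (!α) * p
    cases α <;> simp_all [sgn]

/-- The family `ĥₙ, …, ĥ₁` with the signs `αₙ, …, α₁`. -/
def OutFamily.hatReversed {n : ℕ} (h : OutFamily n) : InFamily n where
  side i := h.side i.rev
  fn i := hat (h.fn i.rev)
  ordered i j hij x hx y hy := by
    have hx' : -x ∈ tsupport (h.fn j.rev) := by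
      have := tsupport_comp_neg (h.fn j.rev)
      exact (this ▸ hx : x ∈ Neg.neg ⁻¹' tsupport (h.fn j.rev))
    have hy' : -y ∈ tsupport (h.fn i.rev) := by
      have := tsupport_comp_neg (h.fn i.rev)
      exact (this ▸ hy : y ∈ Neg.neg ⁻¹' tsupport (h.fn i.rev))
    simpa using h.ordered j.rev i.rev (Fin.rev_lt_rev.2 hij) (-x) hx' (-y) hy'

/-- `S` acts by `S Ω = Ω` and
`S (a†_{α₁}(h₁) ⋯ a†_{αₙ}(hₙ) Ω) = a†_{αₙ}(ĥₙ) ⋯ a†_{α₁}(ĥ₁) Ω` for all families in `ℌ_n`. -/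
def IsScattering {g η : ℝ} (S : outSpace g η →ₗ[ℂ] inSpace g η) : Prop :=
  (∀ v : outSpace g η, (v : Fock g η) = vacuum g η → (S v : Fock g η) = vacuum g η) ∧
  ∀ (n : ℕ) (h : OutFamily n) (v : outSpace g η), (v : Fock g η) = h.state g η →
    (S v : Fock g η) = h.hatReversed.state g η

end ImpurityNLS

end

noncomputable section

namespace ImpurityNLS

/-! ### Weighted compositions -/

section WeightedCompInner

variable {Y : Type*} [MeasurableSpace Y] {ν : Measure Y}

/-! The rapidity of $(\alpha,p)$ is $\alpha p$. On out families the rapidities are positive and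
strictly decreasing, on in families negative and strictly decreasing. These are two chambers for the
group of order $2^n n!$ generated by the permutations and sign changes of the rapidities.

The amplitude $S$ is a coboundary: the unimodular `dressing` absorbs it, so multiplication by its
conjugate carries $\mathcal H^{(n)}$ onto the functions invariant under plain permutations and under
the reflection at every index (`mem_nParticle_iff`). The reflections at different indices are
commuting self-adjoint involutions. Averaging over the group extends any $L^2$ function on a chamber
to an invariant one (`exists_nParticle_extension`), and an invariant function is determined by its
values on one chamber (`eq_zero_of_ae_eq_zero_chamber`).

The extension gives $\langle Pf,Pf'\rangle=(2^n n!)^{-1}\langle f,f'\rangle$ for $f,f'$ supported in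
a common chamber (`inner_projP_projP`). Since nested projections collapse, a product of creation
operators on $\Omega$ is $\sqrt{n!}\,P$ of a pure tensor. The inner product of two $n$-particle out
states is thus $2^{-n}\prod_i\langle \mathfrak h_i,\mathfrak h_i'\rangle$, unchanged by $p\mapsto
-p$ and by reversing the order; in states obey the same formula (`inner_hatReversed_state`).
Determination by a chamber, with the density of products of test functions on boxes, makes both
families total. Two total families with equal Gram matrices are related by a unitary operator, and
$\mathbf S$ is its restriction. -/

theorem integral_comp_involutive {E : Type*} [NormedAddCommGroup E] [NormedSpace ℝ E] {e : Y → Y}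
    (he : MeasurePreserving e ν ν) (hinv : Function.Involutive e) (f : Y → E) :
    ∫ y, f (e y) ∂ν = ∫ y, f y ∂ν :=
  he.integral_comp (MeasurableEquiv.ofInvolutive e hinv he.measurable).measurableEmbedding f

/-- The substitution $y\mapsto e(y)$ moves $e$ from $\varphi$ to $\psi$, and `hconj` turns the
conjugated weight back into $m$. This yields self-adjointness of both the reflection and the
exchange operators. -/
theorem inner_weightedComp_left {m : Y → ℂ} (hm : Measurable m) (hb : ∀ y, ‖m y‖ ≤ 1) {e : Y → Y}
    (he : MeasurePreserving e ν ν) (hinv : Function.Involutive e)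
    (hconj : ∀ y, starRingEnd ℂ (m (e y)) = m y) (φ ψ : Lp ℂ 2 ν) :
    inner ℂ (weightedComp m hm hb e he φ) ψ = inner ℂ φ (weightedComp m hm hb e he ψ) := by
  rw [L2.inner_def, L2.inner_def]
  have h1 : ∫ y, inner ℂ (weightedComp m hm hb e he φ y) (ψ y) ∂ν =
      ∫ y, inner ℂ (m y * φ (e y)) (ψ y) ∂ν := by
    refine integral_congr_ae ?_
    filter_upwards [coeFn_weightedComp m hm hb e he φ] with y hy
    rw [hy]
  have h2 : ∫ y, inner ℂ (φ y) (weightedComp m hm hb e he ψ y) ∂ν =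
      ∫ y, inner ℂ (φ y) (m y * ψ (e y)) ∂ν := by
    refine integral_congr_ae ?_
    filter_upwards [coeFn_weightedComp m hm hb e he ψ] with y hy
    rw [hy]
  rw [h1, h2, ← integral_comp_involutive he hinv]
  refine integral_congr_ae (Filter.Eventually.of_forall fun y => ?_)
  simp only [hinv y, RCLike.inner_apply, map_mul, hconj]
  ring

end WeightedCompInner

/-! ### Null sets -/

theorem ae_rapidity_ne (c : ℝ) : ∀ᵐ y ∂labelMeasure, rapidity y ≠ c := by
  have hs : MeasurableSet {y : Label | rapidity y = c} :=
    measurable_rapidity (measurableSet_singleton c)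
  have : labelMeasure {y : Label | rapidity y = c} = 0 := by
    unfold labelMeasure
    rw [Measure.measure_prod_null hs]
    refine Filter.Eventually.of_forall fun b => ?_
    refine Set.Subsingleton.measure_zero (fun p hp q hq => ?_) _
    simp only [Set.mem_preimage, Set.mem_ofPred_eq, rapidity] at hp hq
    cases b <;> simp [sgn] at hp hq <;> linarith
  rw [ae_iff]
  simpa using this

theorem quasiMeasurePreserving_eval {n : ℕ} (i : Fin n) :
    Measure.QuasiMeasurePreserving (fun x : Fin n → Label => x i) (tensorMeasure n)
      labelMeasure :=
  Measure.quasiMeasurePreserving_eval _ i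

theorem ae_rapidity_apply_ne {n : ℕ} (i : Fin n) (c : ℝ) :
    ∀ᵐ x ∂(tensorMeasure n), rapidity (x i) ≠ c :=
  (quasiMeasurePreserving_eval i).ae (ae_rapidity_ne c)

/-- Fubini after splitting off coordinate $j$: once its rapidity is fixed, the exceptional set
constrains a single coordinate. -/
theorem ae_rapidity_ne_rapidity {n : ℕ} {i j : Fin n} (hij : i ≠ j) :
    ∀ᵐ x ∂(tensorMeasure n), rapidity (x i) ≠ rapidity (x j) := by
  cases n with
  | zero => exact i.elim0
  | succ n =>
    obtain ⟨k, rfl⟩ := Fin.exists_succAbove_eq hij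
    have hmp := (measurePreserving_piFinSuccAbove
      (fun _ : Fin (n + 1) => labelMeasure) j).quasiMeasurePreserving
    have hs : MeasurableSet {z : Label × (Fin n → Label) | rapidity (z.2 k) ≠ rapidity z.1} :=
      (measurableSet_eq_fun ((measurable_rapidity_apply k).comp measurable_snd)
        (measurable_rapidity.comp measurable_fst)).compl
    have : ∀ᵐ z ∂(labelMeasure.prod (tensorMeasure n)), rapidity (z.2 k) ≠ rapidity z.1 := by
      rw [Measure.ae_prod_iff_ae_ae hs]
      exact Filter.Eventually.of_forall fun a => ae_rapidity_apply_ne k (rapidity a)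
    exact hmp.ae this

theorem ae_rapidity_injective (n : ℕ) :
    ∀ᵐ x ∂(tensorMeasure n), Function.Injective fun i => rapidity (x i) := by
  have : ∀ᵐ x ∂(tensorMeasure n), ∀ i j, i ≠ j → rapidity (x i) ≠ rapidity (x j) := by
    simp only [ae_all_iff]
    exact fun i j hij => ae_rapidity_ne_rapidity hij
  filter_upwards [this] with x hx i j h
  by_contra hij
  exact hx i j hij h

/-! ### Reflections -/

@[simp] theorem rapidity_flipSide (y : Label) : rapidity (flipSide y) = -rapidity y := by
  obtain ⟨b, p⟩ := y
  cases b <;> simp [rapidity, flipSide, sgn]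

@[simp] theorem rapidity_flipMomentum (y : Label) : rapidity (flipMomentum y) = -rapidity y := by
  simp [rapidity, flipMomentum]

@[simp] theorem flipSide_flipSide (y : Label) : flipSide (flipSide y) = y := by
  simp [flipSide]

@[simp] theorem flipMomentum_flipMomentum (y : Label) : flipMomentum (flipMomentum y) = y := by
  simp [flipMomentum]

theorem flipMomentum_flipSide (y : Label) :
    flipMomentum (flipSide y) = flipSide (flipMomentum y) := rfl

/-- Conjugation combined with $k\mapsto -k$ changes the sign of both numerator and denominator. The
same reason gives the analogues for $R$ and $S$. As both flips negate the rapidity, this is the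
symmetry needed for self-adjointness. -/
theorem conj_transT_neg (η k : ℝ) : starRingEnd ℂ (transT η (-k)) = transT η k := by
  unfold transT
  simp only [map_div₀, map_add, map_mul, Complex.conj_ofReal, Complex.conj_I,
    Complex.ofReal_neg, map_neg]
  rw [← neg_div_neg_eq]
  congr 1 <;> ring

theorem conj_reflR_neg (η k : ℝ) : starRingEnd ℂ (reflR η (-k)) = reflR η k := by
  unfold reflR
  simp only [map_div₀, map_add, map_mul, map_neg, Complex.conj_ofReal, Complex.conj_I,
    Complex.ofReal_neg]
  rw [← neg_div_neg_eq]
  congr 1 <;> ring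

theorem conj_bulkS_neg (g k : ℝ) : starRingEnd ℂ (bulkS g (-k)) = bulkS g k := by
  unfold bulkS
  simp only [map_div₀, map_add, map_sub, map_mul, map_neg, Complex.conj_ofReal,
    Complex.conj_I, Complex.ofReal_neg]
  rw [← neg_div_neg_eq]
  congr 1 <;> ring

theorem ofReal_add_I_mul_ne_zero {k : ℝ} (hk : k ≠ 0) (c : ℝ) :
    (k : ℂ) + Complex.I * c ≠ 0 := by
  intro h
  have := congrArg Complex.re h
  simp at this
  exact hk this

/-- Unitarity of the impurity, diagonal part; `transT_mul_reflR_add` is the off-diagonal part. The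
case $k=0$ must be excluded because $\eta=0$ would give $0/0$. -/
theorem transT_mul_add_reflR_mul {k : ℝ} (hk : k ≠ 0) (η : ℝ) :
    transT η k * transT η (-k) + reflR η k * reflR η (-k) = 1 := by
  have h1 := ofReal_add_I_mul_ne_zero hk η
  have h2 := ofReal_add_I_mul_ne_zero (neg_ne_zero.2 hk) η
  unfold transT reflR
  rw [div_mul_div_comm, div_mul_div_comm, ← add_div, div_eq_one_iff_eq (mul_ne_zero h1 h2)]
  push_cast
  ring

theorem transT_mul_reflR_add (η k : ℝ) :
    transT η k * reflR η (-k) + reflR η k * transT η (-k) = 0 := by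
  unfold transT reflR
  rw [div_mul_div_comm, div_mul_div_comm, ← add_div]
  push_cast
  ring_nf

theorem coeFn_reflectionOp (η : ℝ) {n : ℕ} (i : Fin n) (φ : TensorPower n) :
    reflectionOp η i φ =ᵐ[tensorMeasure n] fun x =>
      transT η (rapidity (x i)) * φ (Function.update x i (flipSide (x i)))
        + reflR η (rapidity (x i)) * φ (Function.update x i (flipMomentum (x i))) :=
  (Lp.coeFn_add _ _).trans
    ((coeFn_weightedComp _ _ _ _ _ φ).add (coeFn_weightedComp _ _ _ _ _ φ))

theorem involutive_update {n : ℕ} (i : Fin n) {f : Label → Label} (hf : Function.Involutive f) :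
    Function.Involutive fun x : Fin n → Label => Function.update x i (f (x i)) := by
  intro x
  simp [hf (x i)]

theorem inner_reflectionOp_left (η : ℝ) {n : ℕ} (i : Fin n) (φ ψ : TensorPower n) :
    inner ℂ (reflectionOp η i φ) ψ = inner ℂ φ (reflectionOp η i ψ) := by
  unfold reflectionOp
  simp only [add_apply, inner_add_left, inner_add_right]
  congr 1
  · exact inner_weightedComp_left _ _ _ (involutive_update i flipSide_flipSide)
      (fun x => by simp [conj_transT_neg]) _ _
  · exact inner_weightedComp_left _ _ _ (involutive_update i flipMomentum_flipMomentum)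
      (fun x => by simp [conj_reflR_neg]) _ _

theorem ae_update {n : ℕ} (i : Fin n) {f : Label → Label}
    (hf : MeasurePreserving f labelMeasure labelMeasure) {p : (Fin n → Label) → Prop}
    (h : ∀ᵐ x ∂(tensorMeasure n), p x) :
    ∀ᵐ x ∂(tensorMeasure n), p (Function.update x i (f (x i))) :=
  (measurePreserving_update i hf).quasiMeasurePreserving.ae h

/-- The two flips commute and each negates the rapidity, so the square has one term at $x$ and one
at the doubly flipped point. Unitarity makes their coefficients $1$ and $0$. -/
theorem reflectionOp_reflectionOp (η : ℝ) {n : ℕ} (i : Fin n) (φ : TensorPower n) :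
    reflectionOp η i (reflectionOp η i φ) = φ := by
  refine Lp.ext ?_
  have h := coeFn_reflectionOp η i φ
  filter_upwards [coeFn_reflectionOp η i (reflectionOp η i φ),
    ae_update i measurePreserving_flipSide h, ae_update i measurePreserving_flipMomentum h,
    ae_rapidity_apply_ne i 0] with x h0 h1 h2 hx
  rw [h0, h1, h2]
  simp only [Function.update_self, Function.update_idem, rapidity_flipSide,
    rapidity_flipMomentum, flipSide_flipSide, flipMomentum_flipMomentum, Function.update_eq_self,
    flipMomentum_flipSide]
  linear_combination φ x * transT_mul_add_reflR_mul hx η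
    + φ (Function.update x i (flipSide (flipMomentum (x i)))) *
      transT_mul_reflR_add η (rapidity (x i))

theorem reflectionOp_comm (η : ℝ) {n : ℕ} (i j : Fin n) (φ : TensorPower n) :
    reflectionOp η i (reflectionOp η j φ) = reflectionOp η j (reflectionOp η i φ) := by
  rcases eq_or_ne i j with rfl | hij
  · rfl
  refine Lp.ext ?_
  have h := coeFn_reflectionOp η i φ
  have h' := coeFn_reflectionOp η j φ
  filter_upwards [coeFn_reflectionOp η i (reflectionOp η j φ),
    coeFn_reflectionOp η j (reflectionOp η i φ),
    ae_update j measurePreserving_flipSide h, ae_update j measurePreserving_flipMomentum h,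
    ae_update i measurePreserving_flipSide h', ae_update i measurePreserving_flipMomentum h']
    with x h0 h0' h1 h2 h3 h4
  rw [h0, h0', h1, h2, h3, h4]
  simp only [Function.update_of_ne hij, Function.update_of_ne hij.symm]
  simp only [Function.update_comm hij]
  ring

/-! ### Permutations -/

theorem comp_perm_eq_piCongrLeft {n : ℕ} (σ : Equiv.Perm (Fin n)) :
    (fun x : Fin n → Label => x ∘ σ) =
      MeasurableEquiv.piCongrLeft (fun _ : Fin n => Label) σ.symm := by
  ext1 x
  ext1 k
  have := Equiv.piCongrLeft_apply_apply (fun _ : Fin n => Label) σ.symm x (σ k)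
  rw [Equiv.symm_apply_apply] at this
  exact this.symm

theorem measurePreserving_comp_perm {n : ℕ} (σ : Equiv.Perm (Fin n)) :
    MeasurePreserving (fun x : Fin n → Label => x ∘ σ) (tensorMeasure n) (tensorMeasure n) := by
  rw [comp_perm_eq_piCongrLeft]
  exact measurePreserving_piCongrLeft (fun _ : Fin n => labelMeasure) σ.symm

theorem ae_comp_perm {n : ℕ} (σ : Equiv.Perm (Fin n)) {p : (Fin n → Label) → Prop}
    (h : ∀ᵐ x ∂(tensorMeasure n), p x) : ∀ᵐ x ∂(tensorMeasure n), p (x ∘ σ) :=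
  (measurePreserving_comp_perm σ).quasiMeasurePreserving.ae h

/-- The operator permuting the arguments, `φ ↦ (x ↦ φ (x ∘ σ))`. -/
def permOp {n : ℕ} (σ : Equiv.Perm (Fin n)) : TensorPower n →L[ℂ] TensorPower n :=
  weightedComp (fun _ => 1) measurable_const (fun _ => norm_one.le) _
    (measurePreserving_comp_perm σ)

theorem coeFn_permOp {n : ℕ} (σ : Equiv.Perm (Fin n)) (φ : TensorPower n) :
    permOp σ φ =ᵐ[tensorMeasure n] fun x => φ (x ∘ σ) := by
  filter_upwards [coeFn_weightedComp (fun _ => 1) measurable_const (fun _ => norm_one.le) _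
    (measurePreserving_comp_perm σ) φ] with x hx
  rw [permOp, hx, one_mul]

theorem permOp_one {n : ℕ} (φ : TensorPower n) : permOp 1 φ = φ :=
  Lp.ext (coeFn_permOp 1 φ)

theorem permOp_mul {n : ℕ} (σ ρ : Equiv.Perm (Fin n)) (φ : TensorPower n) :
    permOp (σ * ρ) φ = permOp σ (permOp ρ φ) := by
  refine Lp.ext ?_
  filter_upwards [coeFn_permOp (σ * ρ) φ, coeFn_permOp σ (permOp ρ φ),
    ae_comp_perm σ (coeFn_permOp ρ φ)] with x h1 h2 h3
  rw [h1, h2, h3]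
  rfl

theorem inner_permOp_permOp {n : ℕ} (σ : Equiv.Perm (Fin n)) (φ ψ : TensorPower n) :
    inner ℂ (permOp σ φ) (permOp σ ψ) = inner ℂ φ ψ := by
  rw [L2.inner_def, L2.inner_def]
  have hemb : MeasurableEmbedding fun x : Fin n → Label => x ∘ σ := by
    rw [comp_perm_eq_piCongrLeft]
    exact MeasurableEquiv.measurableEmbedding _
  rw [← (measurePreserving_comp_perm σ).integral_comp hemb fun x => inner ℂ (φ x) (ψ x)]
  refine integral_congr_ae ?_
  filter_upwards [coeFn_permOp σ φ, coeFn_permOp σ ψ] with x h1 h2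
  rw [h1, h2]

/-- Conjugation by permutations carries the reflection at one index to the reflection at any other,
so invariance at the last index suffices for permutation invariant functions. -/
theorem permOp_reflectionOp (η : ℝ) {n : ℕ} (σ : Equiv.Perm (Fin n)) (i : Fin n)
    (φ : TensorPower n) :
    permOp σ (reflectionOp η i φ) = reflectionOp η (σ i) (permOp σ φ) := by
  refine Lp.ext ?_
  have h := coeFn_permOp σ φ
  filter_upwards [coeFn_permOp σ (reflectionOp η i φ), coeFn_reflectionOp η (σ i) (permOp σ φ),
    ae_comp_perm σ (coeFn_reflectionOp η i φ),
    ae_update (σ i) measurePreserving_flipSide h,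
    ae_update (σ i) measurePreserving_flipMomentum h] with x h1 h2 h3 h4 h5
  have hu : ∀ v, Function.update x (σ i) v ∘ σ = Function.update (x ∘ σ) i v := fun v => by
    rw [Function.update_comp_eq_of_injective x σ.injective]
  rw [h1, h2, h3, h4, h5, hu, hu]
  rfl

/-! ### Exchange operators -/

theorem involutive_comp_swap {n : ℕ} (i j : Fin n) :
    Function.Involutive fun x : Fin n → Label => x ∘ Equiv.swap i j := by
  intro x
  ext1 k
  simp

theorem coeFn_exchangeOp (g : ℝ) {n : ℕ} (i j : Fin n) (φ : TensorPower n) :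
    exchangeOp g i j φ =ᵐ[tensorMeasure n] fun x =>
      bulkS g (rapidity (x i) - rapidity (x j)) * φ (x ∘ Equiv.swap i j) :=
  coeFn_weightedComp _ _ _ _ _ φ

theorem inner_exchangeOp_left (g : ℝ) {n : ℕ} (i j : Fin n) (φ ψ : TensorPower n) :
    inner ℂ (exchangeOp g i j φ) ψ = inner ℂ φ (exchangeOp g i j ψ) :=
  inner_weightedComp_left _ _ _ (involutive_comp_swap i j)
    (fun x => by
      simp only [Function.comp_apply, Equiv.swap_apply_left, Equiv.swap_apply_right]
      rw [← neg_sub, conj_bulkS_neg]) _ _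

theorem bulkS_mul_bulkS_neg {k : ℝ} (hk : k ≠ 0) (g : ℝ) : bulkS g k * bulkS g (-k) = 1 := by
  have h1 := ofReal_add_I_mul_ne_zero hk g
  have h2 := ofReal_add_I_mul_ne_zero (neg_ne_zero.2 hk) g
  unfold bulkS
  rw [div_mul_div_comm, div_eq_one_iff_eq (mul_ne_zero h1 h2)]
  push_cast
  ring

/-! ### Removal of the two-body amplitude -/

/-- A unimodular function with `phase g k / phase g (-k) = S(k)` for `k ≠ 0`. -/
def phase (g k : ℝ) : ℂ := if 0 < k then bulkS g k else 1

theorem norm_phase (g k : ℝ) : ‖phase g k‖ = 1 := by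
  unfold phase
  split_ifs with hk
  · refine le_antisymm (norm_bulkS_le g k) ?_
    -- Two numbers of modulus at most one whose product is $1$ both have modulus one.
    have h := congrArg norm (bulkS_mul_bulkS_neg hk.ne' g)
    rw [norm_mul, norm_one] at h
    nlinarith [norm_bulkS_le g k, norm_bulkS_le g (-k), norm_nonneg (bulkS g k)]
  · exact norm_one

theorem measurable_phase (g : ℝ) : Measurable (phase g) :=
  Measurable.ite measurableSet_Ioi (measurable_bulkS g) measurable_const

theorem phase_eq_bulkS_mul {k : ℝ} (hk : k ≠ 0) (g : ℝ) :
    phase g k = bulkS g k * phase g (-k) := by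
  unfold phase
  rcases lt_or_gt_of_ne hk with h | h
  · rw [if_neg h.le.not_gt, if_pos (neg_pos.2 h), bulkS_mul_bulkS_neg hk]
  · rw [if_pos h, if_neg (by linarith), mul_one]

/-- The factor `phase (a - b) * phase (a + b)` attached to a pair of rapidities. -/
def pairPhase (g a b : ℝ) : ℂ := phase g (a - b) * phase g (a + b)

theorem norm_pairPhase (g a b : ℝ) : ‖pairPhase g a b‖ = 1 := by
  rw [pairPhase, norm_mul, norm_phase, norm_phase, one_mul]

/-- Negating $b$ only interchanges the two factors. The factor at $a+b$ is included in `pairPhase`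
for the sake of this evenness. -/
theorem pairPhase_neg_right (g a b : ℝ) : pairPhase g a (-b) = pairPhase g a b := by
  rw [pairPhase, pairPhase, sub_neg_eq_add, ← sub_eq_add_neg, mul_comm]

/-- The factor at $a+b$ is symmetric in $a,b$, so only the factor at $a-b$ contributes to the ratio.
-/
theorem pairPhase_eq_bulkS_mul {a b : ℝ} (hab : a ≠ b) (g : ℝ) :
    pairPhase g a b = bulkS g (a - b) * pairPhase g b a := by
  rw [pairPhase, pairPhase, phase_eq_bulkS_mul (sub_ne_zero.2 hab), neg_sub, add_comm b a,
    mul_assoc]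

/-- The product over the pairs `i < j` of the factors `pairPhase`. -/
def dressing (g : ℝ) {n : ℕ} (x : Fin n → Label) : ℂ :=
  ∏ p : Fin n × Fin n,
    if p.1 < p.2 then pairPhase g (rapidity (x p.1)) (rapidity (x p.2)) else 1

theorem norm_dressing (g : ℝ) {n : ℕ} (x : Fin n → Label) : ‖dressing g x‖ = 1 := by
  rw [dressing, norm_prod]
  refine Finset.prod_eq_one fun p _ => ?_
  split_ifs
  · exact norm_pairPhase _ _ _
  · exact norm_one

theorem measurable_dressing (g : ℝ) (n : ℕ) :
    Measurable (dressing g : (Fin n → Label) → ℂ) := by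
  unfold dressing
  refine Finset.measurable_prod _ fun p _ => ?_
  by_cases hp : p.1 < p.2
  · simp only [hp, if_true, pairPhase]
    exact ((measurable_phase g).comp ((measurable_rapidity_apply _).sub
      (measurable_rapidity_apply _))).mul ((measurable_phase g).comp
        ((measurable_rapidity_apply _).add (measurable_rapidity_apply _)))
  · simp only [hp, if_false]
    exact measurable_const

theorem conj_dressing_mul (g : ℝ) {n : ℕ} (x : Fin n → Label) :
    starRingEnd ℂ (dressing g x) * dressing g x = 1 := by
  rw [mul_comm, Complex.mul_conj, Complex.normSq_eq_norm_sq, norm_dressing]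
  simp

/-- The last index occurs only as the second member of an ordered pair, and `pairPhase` is even in
its second argument. This fits the definition of $\mathcal H^{(n)}$, where reflection is imposed at
the last index. -/
theorem dressing_update (g : ℝ) {n : ℕ} {i : Fin n} (hi : (i : ℕ) + 1 = n) (x : Fin n → Label)
    {y : Label} (hy : rapidity y = -rapidity (x i)) :
    dressing g (Function.update x i y) = dressing g x := by
  unfold dressing
  refine Finset.prod_congr rfl fun p _ => ?_
  by_cases hp : p.1 < p.2
  · have h1 : p.1 ≠ i := fun h => by
      have := p.2.2
      rw [h, Fin.lt_def] at hp
      lia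
    rw [if_pos hp, if_pos hp, Function.update_of_ne h1]
    by_cases h2 : p.2 = i
    · rw [h2, Function.update_self, hy, pairPhase_neg_right]
    · rw [Function.update_of_ne h2]
  · rw [if_neg hp, if_neg hp]

theorem swap_lt_swap_iff {n : ℕ} {i j : Fin n} (hij : (i : ℕ) + 1 = j) {a b : Fin n}
    (h1 : ¬ (a = i ∧ b = j)) (h2 : ¬ (a = j ∧ b = i)) :
    Equiv.swap i j a < Equiv.swap i j b ↔ a < b := by
  rw [Equiv.swap_apply_def, Equiv.swap_apply_def]
  simp only [Fin.ext_iff] at *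
  split_ifs <;> simp only [Fin.lt_def] <;> lia

/-- An adjacent transposition reverses the order of no pair other than $(i,j)$ itself, so the two
dressings differ by one factor, whose ratio is $S$. -/
theorem bulkS_mul_dressing_swap (g : ℝ) {n : ℕ} {i j : Fin n} (hij : (i : ℕ) + 1 = j)
    {x : Fin n → Label} (hx : rapidity (x i) ≠ rapidity (x j)) :
    bulkS g (rapidity (x i) - rapidity (x j)) * dressing g (x ∘ Equiv.swap i j) =
      dressing g x := by
  have hlt : i < j := Fin.lt_def.2 (by lia)
  set χ : Fin n → ℝ := fun k => rapidity (x k) with hχ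
  set s := Equiv.swap i j with hs
  have h1 : dressing g (x ∘ s) = ∏ p : Fin n × Fin n,
      if s p.1 < s p.2 then pairPhase g (χ p.1) (χ p.2) else 1 := by
    unfold dressing
    rw [← Equiv.prod_comp (Equiv.prodCongr s s)]
    refine Finset.prod_congr rfl fun p _ => ?_
    simp [hs, hχ]
  -- Each side is completed by the factor it lacks. Writing that factor as a product over all pairs,
  -- trivial except at one, allows a comparison pair by pair.
  have h2 : dressing g x * pairPhase g (χ j) (χ i) =
      dressing g (x ∘ s) * pairPhase g (χ i) (χ j) := by
    have e1 : pairPhase g (χ j) (χ i) =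
        ∏ p : Fin n × Fin n, if p = (j, i) then pairPhase g (χ j) (χ i) else 1 := by simp
    have e2 : pairPhase g (χ i) (χ j) =
        ∏ p : Fin n × Fin n, if p = (i, j) then pairPhase g (χ i) (χ j) else 1 := by simp
    rw [e1, e2, h1, dressing, ← Finset.prod_mul_distrib, ← Finset.prod_mul_distrib]
    refine Finset.prod_congr rfl fun p _ => ?_
    obtain ⟨a, b⟩ := p
    by_cases hp : a = i ∧ b = j
    · obtain ⟨rfl, rfl⟩ := hp
      have : ¬ (a = b ∧ b = a) := fun h => hlt.ne h.1
      simp [hs, hχ, hlt, hlt.not_gt, this]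
    by_cases hp' : a = j ∧ b = i
    · obtain ⟨rfl, rfl⟩ := hp'
      simp [hs, hχ, hlt, hlt.not_gt, hp]
    · simp only [Prod.mk.injEq, hp, hp', if_false, mul_one, hs, swap_lt_swap_iff hij hp hp']
      rfl
  have h3 : pairPhase g (χ j) (χ i) ≠ 0 := by
    rw [← norm_ne_zero_iff, norm_pairPhase]; exact one_ne_zero
  refine mul_right_cancel₀ h3 ?_
  rw [h2, pairPhase_eq_bulkS_mul hx]
  ring

/-- Multiplication by the dressing factor. -/
def dressOp (g : ℝ) (n : ℕ) : TensorPower n →L[ℂ] TensorPower n :=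
  weightedComp (dressing g) (measurable_dressing g n) (fun x => (norm_dressing g x).le) id
    (MeasurePreserving.id _)

/-- Multiplication by the complex conjugate of the dressing factor. -/
def undressOp (g : ℝ) (n : ℕ) : TensorPower n →L[ℂ] TensorPower n :=
  weightedComp (fun x => starRingEnd ℂ (dressing g x))
    (Complex.continuous_conj.measurable.comp (measurable_dressing g n))
    (fun x => ((Complex.norm_conj _).trans (norm_dressing g x)).le) id (MeasurePreserving.id _)

theorem coeFn_dressOp (g : ℝ) {n : ℕ} (φ : TensorPower n) :
    dressOp g n φ =ᵐ[tensorMeasure n] fun x => dressing g x * φ x :=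
  coeFn_weightedComp _ _ _ _ (MeasurePreserving.id _) φ

theorem coeFn_undressOp (g : ℝ) {n : ℕ} (φ : TensorPower n) :
    undressOp g n φ =ᵐ[tensorMeasure n] fun x => starRingEnd ℂ (dressing g x) * φ x :=
  coeFn_weightedComp _ _ _ _ (MeasurePreserving.id _) φ

theorem undressOp_dressOp (g : ℝ) {n : ℕ} (φ : TensorPower n) :
    undressOp g n (dressOp g n φ) = φ := by
  refine Lp.ext ?_
  filter_upwards [coeFn_undressOp g (dressOp g n φ), coeFn_dressOp g φ] with x h1 h2
  rw [h1, h2, ← mul_assoc, conj_dressing_mul, one_mul]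

theorem dressOp_undressOp (g : ℝ) {n : ℕ} (φ : TensorPower n) :
    dressOp g n (undressOp g n φ) = φ := by
  refine Lp.ext ?_
  filter_upwards [coeFn_dressOp g (undressOp g n φ), coeFn_undressOp g φ] with x h1 h2
  rw [h1, h2, ← mul_assoc, mul_comm (dressing g x), conj_dressing_mul, one_mul]

theorem undressOp_injective (g : ℝ) (n : ℕ) : Function.Injective (undressOp g n) :=
  Function.LeftInverse.injective (dressOp_undressOp g)

theorem inner_undressOp_undressOp (g : ℝ) {n : ℕ} (φ ψ : TensorPower n) :
    inner ℂ (undressOp g n φ) (undressOp g n ψ) = inner ℂ φ ψ := by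
  rw [L2.inner_def, L2.inner_def]
  refine integral_congr_ae ?_
  filter_upwards [coeFn_undressOp g φ, coeFn_undressOp g ψ] with x h1 h2
  rw [h1, h2]
  simp only [RCLike.inner_apply, map_mul, Complex.conj_conj]
  linear_combination (ψ x * starRingEnd ℂ (φ x)) * conj_dressing_mul g x

theorem reflectionOp_undressOp (g η : ℝ) {n : ℕ} {i : Fin n} (hi : (i : ℕ) + 1 = n)
    (φ : TensorPower n) :
    reflectionOp η i (undressOp g n φ) = undressOp g n (reflectionOp η i φ) := by
  refine Lp.ext ?_
  have h := coeFn_undressOp g φ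
  filter_upwards [coeFn_reflectionOp η i (undressOp g n φ),
    coeFn_undressOp g (reflectionOp η i φ), coeFn_reflectionOp η i φ,
    ae_update i measurePreserving_flipSide h, ae_update i measurePreserving_flipMomentum h]
    with x h1 h2 h3 h4 h5
  rw [h1, h2, h3, h4, h5, dressing_update g hi x (rapidity_flipSide _),
    dressing_update g hi x (rapidity_flipMomentum _)]
  ring

/-- The dressing ratio under an adjacent swap is exactly $S$, so undressing turns the exchange with
amplitude into a bare permutation. -/
theorem permOp_swap_undressOp (g : ℝ) {n : ℕ} {i j : Fin n} (hij : (i : ℕ) + 1 = j)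
    (φ : TensorPower n) :
    permOp (Equiv.swap i j) (undressOp g n φ) = undressOp g n (exchangeOp g i j φ) := by
  refine Lp.ext ?_
  have hne : i ≠ j := fun h => by rw [h] at hij; lia
  filter_upwards [coeFn_permOp (Equiv.swap i j) (undressOp g n φ),
    ae_comp_perm (Equiv.swap i j) (coeFn_undressOp g φ),
    coeFn_undressOp g (exchangeOp g i j φ), coeFn_exchangeOp g i j φ,
    ae_rapidity_ne_rapidity hne] with x h1 h2 h3 h4 h5
  rw [h1, h2, h3, h4, ← bulkS_mul_dressing_swap g hij h5, map_mul]
  have h6 : starRingEnd ℂ (bulkS g (rapidity (x i) - rapidity (x j))) *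
      bulkS g (rapidity (x i) - rapidity (x j)) = 1 := by
    rw [← conj_bulkS_neg g (rapidity (x i) - rapidity (x j)), Complex.conj_conj,
      conj_bulkS_neg, mul_comm, bulkS_mul_bulkS_neg (sub_ne_zero.2 h5)]
  linear_combination (-(starRingEnd ℂ (dressing g (x ∘ Equiv.swap i j)) *
    φ (x ∘ Equiv.swap i j))) * h6

/-! ### Full invariance -/

/-- Invariance under all reflections and all permutations. -/
def IsFullyInvariant (η : ℝ) {n : ℕ} (φ : TensorPower n) : Prop :=
  (∀ i, reflectionOp η i φ = φ) ∧ ∀ σ, permOp σ φ = φ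

/-- Adjacent transpositions generate the symmetric group, already as a monoid, so no inverses have
to be treated. -/
theorem permOp_eq_self_of_swap {n : ℕ} {φ : TensorPower n}
    (h : ∀ i j : Fin n, (i : ℕ) + 1 = j → permOp (Equiv.swap i j) φ = φ)
    (σ : Equiv.Perm (Fin n)) : permOp σ φ = φ := by
  cases n with
  | zero => rw [Subsingleton.elim σ 1, permOp_one]
  | succ n =>
    have hσ : σ ∈ Submonoid.closure
        (Set.range fun i : Fin n => Equiv.swap i.castSucc i.succ) := by
      rw [Equiv.Perm.mclosure_swap_castSucc_succ]; trivial
    induction hσ using Submonoid.closure_induction with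
    | mem σ hσ =>
      obtain ⟨i, rfl⟩ := hσ
      exact h _ _ (by simp)
    | one => exact permOp_one φ
    | mul σ ρ _ _ h1 h2 => rw [permOp_mul, h2, h1]

theorem mem_nParticle_iff (g η : ℝ) {n : ℕ} (φ : TensorPower n) :
    φ ∈ nParticle g η n ↔ IsFullyInvariant η (undressOp g n φ) := by
  have hmem : φ ∈ nParticle g η n ↔ (∀ i : Fin n, (i : ℕ) + 1 = n → reflectionOp η i φ = φ) ∧
      ∀ i j : Fin n, (i : ℕ) + 1 = j → exchangeOp g i j φ = φ := by
    simp only [← isReflectionInvariant_iff, ← isExchangeInvariant_iff]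
    rfl
  rw [hmem]
  constructor
  · rintro ⟨h1, h2⟩
    have hp : ∀ σ, permOp σ (undressOp g n φ) = undressOp g n φ :=
      permOp_eq_self_of_swap fun i j hij => by rw [permOp_swap_undressOp g hij, h2 i j hij]
    refine ⟨fun i => ?_, hp⟩
    have hn : n - 1 < n := Nat.sub_lt i.pos one_pos
    -- The reflection at $i$ is the one at the last index conjugated by the transposition of $i$
    -- with it.
    have := permOp_reflectionOp η (Equiv.swap ⟨n - 1, hn⟩ i) ⟨n - 1, hn⟩ (undressOp g n φ)
    have hlast : ((⟨n - 1, hn⟩ : Fin n) : ℕ) + 1 = n := Nat.sub_add_cancel i.pos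
    rw [reflectionOp_undressOp g η hlast, h1 _ hlast, hp, Equiv.swap_apply_left] at this
    exact this.symm
  · rintro ⟨h1, h2⟩
    exact ⟨fun i hi => undressOp_injective g n (by rw [← reflectionOp_undressOp g η hi, h1]),
      fun i j hij => undressOp_injective g n (by rw [← permOp_swap_undressOp g hij, h2])⟩

/-! ### Chambers -/

/-- The points all of whose rapidities have the sign `ε`. -/
def orthant (ε : Side) (n : ℕ) : Set (Fin n → Label) := {x | ∀ i, 0 < sgn ε * rapidity (x i)}

/-- The points of the orthant with strictly decreasing rapidities. -/
def chamber (ε : Side) (n : ℕ) : Set (Fin n → Label) :=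
  {x | x ∈ orthant ε n ∧ ∀ i j, i < j → rapidity (x j) < rapidity (x i)}

theorem comp_perm_mem_orthant {ε : Side} {n : ℕ} {x : Fin n → Label} (hx : x ∈ orthant ε n)
    (σ : Equiv.Perm (Fin n)) : x ∘ σ ∈ orthant ε n := fun i => hx (σ i)

/-- Such a permutation is an order automorphism of `Fin n`, and the identity is the only one. Hence
distinct permutations of a chamber are disjoint. -/
theorem eq_one_of_mem_chamber {ε : Side} {n : ℕ} {x : Fin n → Label} (hx : x ∈ chamber ε n)
    {σ : Equiv.Perm (Fin n)} (hσ : x ∘ σ ∈ chamber ε n) : σ = 1 := by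
  have h : StrictMono σ := by
    intro i j hij
    by_contra hlt
    rcases (not_lt.1 hlt).eq_or_lt with h | h
    · exact hij.ne (σ.injective h.symm)
    · exact lt_asymm (hσ.2 i j hij) (hx.2 _ _ h)
  ext1 i
  exact congrArg (fun e : Fin n ≃o Fin n => e i)
    (Subsingleton.elim (h.orderIsoOfSurjective σ σ.surjective) (OrderIso.refl (Fin n)))

theorem exists_comp_perm_mem_chamber {ε : Side} {n : ℕ} {x : Fin n → Label}
    (hx : x ∈ orthant ε n) (hinj : Function.Injective fun i => rapidity (x i)) :
    ∃ σ : Equiv.Perm (Fin n), x ∘ σ ∈ chamber ε n := by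
  -- `Tuple.sort` sorts increasingly; the sign makes the rapidities decrease.
  refine ⟨Tuple.sort fun i => -rapidity (x i), comp_perm_mem_orthant hx _, fun i j hij => ?_⟩
  have h := Tuple.monotone_sort (fun i => -rapidity (x i)) hij.le
  simp only [Function.comp_apply, neg_le_neg_iff] at h ⊢
  exact lt_of_le_of_ne h fun h' => hij.ne ((Equiv.injective _ (hinj h')).symm)

/-! ### Extension from a chamber -/

/-- The set $s$ holds the indices already symmetrized. Passing from $k$ to $k$ plus its reflection
at a new index $j$ keeps the earlier invariances, since reflections commute, and adds invariance at
$j$, since they are involutions. On the orthant nothing changes: the new term evaluates $k$ where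
coordinate $j$ has the wrong sign, and there $k$ vanishes. Self-adjointness doubles the inner
product with invariant vectors. -/
theorem exists_reflection_invariant_extension (η : ℝ) {ε : Side} {n : ℕ} {f : TensorPower n}
    (hf : ∀ᵐ x ∂(tensorMeasure n), x ∉ orthant ε n → f x = 0) (s : Finset (Fin n)) :
    ∃ k : TensorPower n, (∀ i ∈ s, reflectionOp η i k = k) ∧
      (∀ᵐ x ∂(tensorMeasure n), (∃ i ∉ s, ¬ 0 < sgn ε * rapidity (x i)) → k x = 0) ∧
      (∀ᵐ x ∂(tensorMeasure n), x ∈ orthant ε n → k x = f x) ∧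
      ∀ ψ : TensorPower n, (∀ i, reflectionOp η i ψ = ψ) →
        inner ℂ k ψ = 2 ^ s.card * inner ℂ f ψ := by
  induction s using Finset.induction_on with
  | empty =>
    refine ⟨f, by simp, ?_, Filter.Eventually.of_forall fun _ _ => rfl, by simp⟩
    filter_upwards [hf] with x hx
    rintro ⟨i, -, hi⟩
    exact hx fun h => hi (h i)
  | insert j s hj ih =>
    obtain ⟨k, h1, h2, h3, h4⟩ := ih
    have hS := ae_update j measurePreserving_flipSide h2
    have hM := ae_update j measurePreserving_flipMomentum h2
    refine ⟨k + reflectionOp η j k, ?_, ?_, ?_, ?_⟩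
    · intro i hi
      rw [map_add]
      rcases Finset.mem_insert.1 hi with rfl | hi
      · rw [reflectionOp_reflectionOp, add_comm]
      · rw [reflectionOp_comm, h1 i hi]
    · filter_upwards [h2, hS, hM, Lp.coeFn_add k (reflectionOp η j k), coeFn_reflectionOp η j k]
        with x a b c d e
      rintro ⟨i, hi, hpos⟩
      rw [Finset.mem_insert, not_or] at hi
      rw [d, Pi.add_apply, e, a ⟨i, hi.2, hpos⟩,
        b ⟨i, hi.2, by rwa [Function.update_of_ne hi.1]⟩,
        c ⟨i, hi.2, by rwa [Function.update_of_ne hi.1]⟩]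
      simp
    · filter_upwards [h3, hS, hM, Lp.coeFn_add k (reflectionOp η j k), coeFn_reflectionOp η j k]
        with x a b c d e hx
      have hxj := hx j
      rw [d, Pi.add_apply, e, a hx,
        b ⟨j, hj, by rw [Function.update_self, rapidity_flipSide]; linarith⟩,
        c ⟨j, hj, by rw [Function.update_self, rapidity_flipMomentum]; linarith⟩]
      simp
    · intro ψ hψ
      rw [inner_add_left, inner_reflectionOp_left, hψ, h4 ψ hψ, Finset.card_insert_of_notMem hj]
      ring

/-- Sum the reflection invariant extension over all permutations; on the chamber only the identity
contributes. The constant is the order of the group. -/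
theorem exists_invariant_extension (η : ℝ) {ε : Side} {n : ℕ} {f : TensorPower n}
    (hf : ∀ᵐ x ∂(tensorMeasure n), x ∉ chamber ε n → f x = 0) :
    ∃ φ : TensorPower n, IsFullyInvariant η φ ∧
      (∀ᵐ x ∂(tensorMeasure n), x ∈ chamber ε n → φ x = f x) ∧
      ∀ ψ : TensorPower n, IsFullyInvariant η ψ →
        inner ℂ φ ψ = 2 ^ n * (n.factorial : ℂ) * inner ℂ f ψ := by
  obtain ⟨k, h1, -, h3, h4⟩ := exists_reflection_invariant_extension η (f := f)
    (hf.mono fun x hx h => hx fun h' => h h'.1) Finset.univ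
  refine ⟨∑ σ, permOp σ k, ⟨fun i => ?_, fun ρ => ?_⟩, ?_, fun ψ hψ => ?_⟩
  · rw [map_sum]
    refine Finset.sum_congr rfl fun σ _ => ?_
    have := permOp_reflectionOp η σ (σ.symm i) k
    rw [h1 _ (Finset.mem_univ _), Equiv.apply_symm_apply] at this
    exact this.symm
  · rw [map_sum, ← Equiv.sum_comp (Equiv.mulLeft ρ) fun σ => permOp σ k]
    exact Finset.sum_congr rfl fun σ _ => (permOp_mul ρ σ k).symm
  · have hperm : ∀ᵐ x ∂(tensorMeasure n), ∀ σ : Equiv.Perm (Fin n),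
        permOp σ k x = k (x ∘ σ) ∧ (x ∘ σ ∈ orthant ε n → k (x ∘ σ) = f (x ∘ σ)) ∧
          (x ∘ σ ∉ chamber ε n → f (x ∘ σ) = 0) := by
      rw [ae_all_iff]
      intro σ
      filter_upwards [coeFn_permOp σ k, ae_comp_perm σ h3, ae_comp_perm σ hf] with x a b c
      exact ⟨a, b, c⟩
    filter_upwards [Lp.coeFn_finsetSum Finset.univ fun σ => permOp σ k, hperm] with x hx hσ hmem
    rw [hx, Finset.sum_apply, Finset.sum_eq_single 1]
    · obtain ⟨a, b, -⟩ := hσ 1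
      rw [a, b (comp_perm_mem_orthant hmem.1 1)]
      rfl
    · intro σ _ hne
      obtain ⟨a, b, c⟩ := hσ σ
      rw [a, b (comp_perm_mem_orthant hmem.1 σ), c fun h => hne (eq_one_of_mem_chamber hmem h)]
    · simp
  · have : ∀ σ, inner ℂ (permOp σ k) ψ = inner ℂ k ψ := fun σ => by
      conv_lhs => rw [← hψ.2 σ, inner_permOp_permOp]
    rw [sum_inner, Finset.sum_congr rfl fun σ _ => this σ, h4 ψ hψ.1, Finset.sum_const,
      Finset.card_univ, Fintype.card_perm, Fintype.card_fin, nsmul_eq_mul, Finset.card_univ,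
      Fintype.card_fin]
    ring

/-- A function supported in a chamber is the restriction of an `n`-particle function. -/
theorem exists_nParticle_extension (g η : ℝ) {ε : Side} {n : ℕ} {f : TensorPower n}
    (hf : ∀ᵐ x ∂(tensorMeasure n), x ∉ chamber ε n → f x = 0) :
    ∃ φ ∈ nParticle g η n,
      (∀ᵐ x ∂(tensorMeasure n), x ∈ chamber ε n → φ x = f x) ∧
      ∀ ψ ∈ nParticle g η n, inner ℂ φ ψ = 2 ^ n * (n.factorial : ℂ) * inner ℂ f ψ := by
  have hf' : ∀ᵐ x ∂(tensorMeasure n), x ∉ chamber ε n → undressOp g n f x = 0 := by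
    filter_upwards [hf, coeFn_undressOp g f] with x a b hx
    rw [b, a hx, mul_zero]
  obtain ⟨φ, h1, h2, h3⟩ := exists_invariant_extension η hf'
  refine ⟨dressOp g n φ, ?_, ?_, fun ψ hψ => ?_⟩
  · rwa [mem_nParticle_iff, undressOp_dressOp]
  · filter_upwards [h2, coeFn_dressOp g φ, coeFn_dressOp g (undressOp g n f)] with x a b c hx
    rw [b, a hx, ← c, dressOp_undressOp]
  · rw [← inner_undressOp_undressOp g, undressOp_dressOp, h3 _ ((mem_nParticle_iff g η ψ).1 hψ),
      inner_undressOp_undressOp]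

/-! ### Inner products of projected chamber functions -/

theorem inner_projP_left (g η : ℝ) {n : ℕ} (f : TensorPower n) (ψ : nParticle g η n) :
    inner ℂ (projP g η n f) ψ = inner ℂ f (ψ : TensorPower n) := by
  unfold projP
  exact Submodule.inner_orthogonalProjectionOnto_eq_of_mem_right ψ f

/-- With $\varphi$ the invariant extension of $f$, the inner product on the left is $(2^n
n!)^{-1}\langle\varphi,Pf'\rangle$. Invariance of $\varphi$ removes the remaining projection, and
$\varphi=f$ on the chamber that carries $f'$. -/
theorem inner_projP_projP (g η : ℝ) {ε : Side} {n : ℕ} {f f' : TensorPower n}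
    (hf : ∀ᵐ x ∂(tensorMeasure n), x ∉ chamber ε n → f x = 0)
    (hf' : ∀ᵐ x ∂(tensorMeasure n), x ∉ chamber ε n → f' x = 0) :
    inner ℂ (projP g η n f) (projP g η n f') =
      (2 ^ n * (n.factorial : ℂ))⁻¹ * inner ℂ f f' := by
  obtain ⟨φ, h1, h2, h3⟩ := exists_nParticle_extension g η hf
  have hN : (2 ^ n * (n.factorial : ℂ)) ≠ 0 :=
    mul_ne_zero (pow_ne_zero _ two_ne_zero) (Nat.cast_ne_zero.2 n.factorial_ne_zero)
  rw [inner_projP_left, eq_inv_mul_iff_mul_eq₀ hN, ← h3 _ (projP g η n f').2,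
    ← inner_conj_symm]
  have h4 := inner_projP_left g η f' ⟨φ, h1⟩
  rw [Submodule.coe_inner] at h4
  rw [h4, inner_conj_symm, L2.inner_def, L2.inner_def]
  refine integral_congr_ae ?_
  filter_upwards [h2, hf'] with x a b
  by_cases hx : x ∈ chamber ε n
  · rw [a hx]
  · rw [b hx, inner_zero_right, inner_zero_right]

/-! ### Determination by the restriction to a chamber -/

theorem eq_zero_of_ae_eq_zero_chamber (g η : ℝ) (ε : Side) {n : ℕ} {φ : TensorPower n}
    (hφ : φ ∈ nParticle g η n) (h0 : ∀ᵐ x ∂(tensorMeasure n), x ∈ chamber ε n → φ x = 0) :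
    φ = 0 := by
  obtain ⟨h1, h2⟩ := (mem_nParticle_iff g η φ).1 hφ
  set ψ := undressOp g n φ with hψ
  have hch : ∀ᵐ x ∂(tensorMeasure n), x ∈ chamber ε n → ψ x = 0 := by
    filter_upwards [h0, coeFn_undressOp g φ] with x a b hx
    rw [b, a hx, mul_zero]
  have hperm : ∀ᵐ x ∂(tensorMeasure n), ∀ σ : Equiv.Perm (Fin n),
      x ∘ σ ∈ chamber ε n → ψ x = 0 := by
    rw [ae_all_iff]
    intro σ
    have := coeFn_permOp σ ψ
    rw [h2 σ] at this
    filter_upwards [this, ae_comp_perm σ hch] with x a b hx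
    rw [a, b hx]
  -- The set $s$ collects the indices whose rapidity sign is unrestricted. Reflection invariance at
  -- a new index expresses $\psi(x)$ by values at points where that sign is reversed; zero
  -- rapidities are a null set.
  have hor : ∀ s : Finset (Fin n), ∀ᵐ x ∂(tensorMeasure n),
      (∀ i ∉ s, 0 < sgn ε * rapidity (x i)) → ψ x = 0 := by
    intro s
    induction s using Finset.induction_on with
    | empty =>
      filter_upwards [hperm, ae_rapidity_injective n] with x a b hx
      obtain ⟨σ, hσ⟩ := exists_comp_perm_mem_chamber (fun i => hx i (Finset.notMem_empty i)) b
      exact a σ hσ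
    | insert j s hj ih =>
      have := coeFn_reflectionOp η j ψ
      rw [h1 j] at this
      filter_upwards [ih, ae_update j measurePreserving_flipSide ih,
        ae_update j measurePreserving_flipMomentum ih, this, ae_rapidity_apply_ne j 0]
        with x a b c d e hx
      have hs : ∀ i ∉ s, i ≠ j → 0 < sgn ε * rapidity (x i) := fun i hi hij =>
        hx i (by simp [hi, hij])
      by_cases hpos : 0 < sgn ε * rapidity (x j)
      · exact a fun i hi => by
          by_cases hij : i = j
          · rwa [hij]
          · exact hs i hi hij
      · have hne : sgn ε * rapidity (x j) ≠ 0 :=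
          mul_ne_zero (by cases ε <;> simp [sgn]) e
        have hneg : 0 < sgn ε * -rapidity (x j) := by
          have := lt_of_le_of_ne (not_lt.1 hpos) hne
          linarith
        rw [d, b, c]
        · simp
        · intro i hi
          by_cases hij : i = j
          · rw [hij, Function.update_self, rapidity_flipMomentum]; exact hneg
          · rw [Function.update_of_ne hij]; exact hs i hi hij
        · intro i hi
          by_cases hij : i = j
          · rw [hij, Function.update_self, rapidity_flipSide]; exact hneg
          · rw [Function.update_of_ne hij]; exact hs i hi hij
  refine undressOp_injective g n ?_
  rw [map_zero, ← hψ]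
  refine Lp.ext ?_
  filter_upwards [hor Finset.univ, Lp.coeFn_zero ℂ 2 (tensorMeasure n)] with x a b
  rw [a (by simp), b, Pi.zero_apply]

/-! ### Tensor products -/

theorem coeFn_tensorLeft (f : OneParticle) {n : ℕ} (φ : TensorPower n) :
    tensorLeft f n φ =ᵐ[tensorMeasure (n + 1)] fun x => f (x 0) * φ (fun i => x i.succ) :=
  (memLp_tensor f φ).coeFn_toLp

theorem integral_tensorMeasure_succ {n : ℕ} (F : Label → ℂ) (G : (Fin n → Label) → ℂ) :
    ∫ x, F (x 0) * G (fun i => x i.succ) ∂(tensorMeasure (n + 1)) =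
      (∫ y, F y ∂labelMeasure) * ∫ x, G x ∂(tensorMeasure n) := by
  rw [← integral_prod_mul]
  exact (measurePreserving_piFinSuccAbove (fun _ : Fin (n + 1) => labelMeasure) 0).integral_comp
    (MeasurableEquiv.measurableEmbedding _)
    fun z : Label × (Fin n → Label) => F z.1 * G z.2

theorem inner_tensorLeft_tensorLeft (f f' : OneParticle) {n : ℕ} (φ φ' : TensorPower n) :
    inner ℂ (tensorLeft f n φ) (tensorLeft f' n φ') = inner ℂ f f' * inner ℂ φ φ' := by
  rw [L2.inner_def, L2.inner_def, L2.inner_def,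
    ← integral_tensorMeasure_succ (fun y => inner ℂ (f y) (f' y)) fun x => inner ℂ (φ x) (φ' x)]
  refine integral_congr_ae ?_
  filter_upwards [coeFn_tensorLeft f φ, coeFn_tensorLeft f' φ'] with x h1 h2
  rw [h1, h2]
  simp only [RCLike.inner_apply, map_mul]
  ring

theorem norm_tensorLeft (f : OneParticle) {n : ℕ} (φ : TensorPower n) :
    ‖tensorLeft f n φ‖ = ‖f‖ * ‖φ‖ := by
  have h := inner_tensorLeft_tensorLeft f f φ φ
  simp only [inner_self_eq_norm_sq_to_K] at h
  have h' : ‖tensorLeft f n φ‖ ^ 2 = (‖f‖ * ‖φ‖) ^ 2 := by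
    rw [mul_pow]
    exact_mod_cast h
  exact (pow_left_inj₀ (norm_nonneg _) (by positivity) two_ne_zero).1 h'

/-- `φ ↦ f ⊗ φ` as a bounded operator. -/
def tensorLeftL (f : OneParticle) (n : ℕ) : TensorPower n →L[ℂ] TensorPower (n + 1) :=
  (tensorLeft f n).mkContinuous ‖f‖ fun φ => (norm_tensorLeft f φ).le

/-- `f ↦ f ⊗ φ` as a bounded operator. -/
def tensorRightL {n : ℕ} (φ : TensorPower n) : OneParticle →L[ℂ] TensorPower (n + 1) :=
  LinearMap.mkContinuous
    { toFun := fun f => tensorLeft f n φ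
      map_add' := by
        intro f f'
        refine Lp.ext ?_
        filter_upwards [coeFn_tensorLeft (f + f') φ, coeFn_tensorLeft f φ, coeFn_tensorLeft f' φ,
          Lp.coeFn_add (tensorLeft f n φ) (tensorLeft f' n φ),
          (quasiMeasurePreserving_eval 0).ae (Lp.coeFn_add f f')] with x h1 h2 h3 h4 h5
        rw [h1, h4, Pi.add_apply, h2, h3, h5, Pi.add_apply, add_mul]
      map_smul' := by
        intro c f
        refine Lp.ext ?_
        filter_upwards [coeFn_tensorLeft (c • f) φ, coeFn_tensorLeft f φ,
          Lp.coeFn_smul c (tensorLeft f n φ),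
          (quasiMeasurePreserving_eval 0).ae (Lp.coeFn_smul c f)] with x h1 h2 h3 h4
        rw [RingHom.id_apply, h1, h3, Pi.smul_apply, h2, h4, Pi.smul_apply, smul_eq_mul,
          smul_eq_mul, mul_assoc] }
    ‖φ‖ fun f => ((norm_tensorLeft f φ).trans (mul_comm _ _)).le

theorem ae_tail {n : ℕ} {p : (Fin n → Label) → Prop} (h : ∀ᵐ x ∂(tensorMeasure n), p x) :
    ∀ᵐ x ∂(tensorMeasure (n + 1)), p fun i => x i.succ :=
  (quasiMeasurePreserving_tail n).ae h

theorem tail_update_succ {n : ℕ} (x : Fin (n + 1) → Label) (i : Fin n) (y : Label) :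
    (fun k : Fin n => Function.update x i.succ y k.succ) =
      Function.update (fun k : Fin n => x k.succ) i y := by
  ext1 k
  by_cases h : k = i
  · rw [h, Function.update_self, Function.update_self]
  · rw [Function.update_of_ne h, Function.update_of_ne (fun h' => h (Fin.succ_injective n h'))]

theorem reflectionOp_succ_tensorLeft (η : ℝ) (f : OneParticle) {n : ℕ} (i : Fin n)
    (φ : TensorPower n) :
    reflectionOp η i.succ (tensorLeft f n φ) = tensorLeft f n (reflectionOp η i φ) := by
  refine Lp.ext ?_
  have h := coeFn_tensorLeft f φ
  filter_upwards [coeFn_reflectionOp η i.succ (tensorLeft f n φ),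
    coeFn_tensorLeft f (reflectionOp η i φ), ae_tail (coeFn_reflectionOp η i φ),
    ae_update i.succ measurePreserving_flipSide h,
    ae_update i.succ measurePreserving_flipMomentum h] with x h1 h2 h3 h4 h5
  rw [h1, h2, h3, h4, h5, tail_update_succ, tail_update_succ,
    Function.update_of_ne (Fin.succ_ne_zero i).symm,
    Function.update_of_ne (Fin.succ_ne_zero i).symm]
  ring

theorem exchangeOp_succ_tensorLeft (g : ℝ) (f : OneParticle) {n : ℕ} (i j : Fin n)
    (φ : TensorPower n) :
    exchangeOp g i.succ j.succ (tensorLeft f n φ) = tensorLeft f n (exchangeOp g i j φ) := by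
  refine Lp.ext ?_
  filter_upwards [coeFn_exchangeOp g i.succ j.succ (tensorLeft f n φ),
    coeFn_tensorLeft f (exchangeOp g i j φ), ae_tail (coeFn_exchangeOp g i j φ),
    (measurePreserving_swap i.succ j.succ).quasiMeasurePreserving.ae (coeFn_tensorLeft f φ)]
    with x h1 h2 h3 h4
  have h5 : (x ∘ Equiv.swap i.succ j.succ) 0 = x 0 := by
    rw [Function.comp_apply, Equiv.swap_apply_of_ne_of_ne (Fin.succ_ne_zero i).symm
      (Fin.succ_ne_zero j).symm]
  have h6 : (fun k : Fin n => (x ∘ Equiv.swap i.succ j.succ) k.succ) =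
      (fun k : Fin n => x k.succ) ∘ Equiv.swap i j := by
    ext1 k
    simp only [Function.comp_apply]
    rw [(Fin.succ_injective n).swap_apply]
  rw [h1, h2, h3, h4, h5, h6]
  ring

/-- Prepending a factor commutes with the operators at the shifted indices, the last index remains
last, and consecutive indices remain consecutive. Thus the annihilation operator preserves the
$n$-particle spaces with no projection. -/
theorem adjoint_tensorLeftL_mem (g η : ℝ) (f : OneParticle) {n : ℕ} {φ : TensorPower (n + 1)}
    (hφ : φ ∈ nParticle g η (n + 1)) :
    (tensorLeftL f n).adjoint φ ∈ nParticle g η n := by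
  refine ⟨fun i hi => ?_, fun i j hij => ?_⟩
  · rw [isReflectionInvariant_iff]
    refine ext_inner_left ℂ fun ψ => ?_
    have h := (isReflectionInvariant_iff η i.succ φ).1 (hφ.1 i.succ (by simp [hi]))
    rw [← inner_reflectionOp_left, ContinuousLinearMap.adjoint_inner_right,
      ContinuousLinearMap.adjoint_inner_right]
    change inner ℂ (tensorLeft f n _) φ = inner ℂ (tensorLeft f n _) φ
    rw [← reflectionOp_succ_tensorLeft, inner_reflectionOp_left, h]
  · rw [isExchangeInvariant_iff]
    refine ext_inner_left ℂ fun ψ => ?_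
    have h := (isExchangeInvariant_iff g i.succ j.succ φ).1 (hφ.2 i.succ j.succ (by simp [hij]))
    rw [← inner_exchangeOp_left, ContinuousLinearMap.adjoint_inner_right,
      ContinuousLinearMap.adjoint_inner_right]
    change inner ℂ (tensorLeft f n _) φ = inner ℂ (tensorLeft f n _) φ
    rw [← exchangeOp_succ_tensorLeft, inner_exchangeOp_left, h]

/-- By duality with `adjoint_tensorLeftL_mem` the inner projection can be dropped, so a string of
creation operators needs a single projection. -/
theorem projP_tensorLeft_projP (g η : ℝ) (f : OneParticle) {n : ℕ} (φ : TensorPower n) :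
    projP g η (n + 1) (tensorLeft f n (projP g η n φ)) =
      projP g η (n + 1) (tensorLeft f n φ) := by
  refine ext_inner_right ℂ fun ψ => ?_
  rw [inner_projP_left, inner_projP_left]
  change inner ℂ (tensorLeftL f n (projP g η n φ : TensorPower n)) (ψ : TensorPower (n + 1)) =
    inner ℂ (tensorLeftL f n φ) (ψ : TensorPower (n + 1))
  rw [← ContinuousLinearMap.adjoint_inner_right, ← ContinuousLinearMap.adjoint_inner_right]
  exact inner_projP_left g η φ ⟨_, adjoint_tensorLeftL_mem g η f ψ.2⟩

/-- The tensor product `f₁ ⊗ ⋯ ⊗ fₙ`. -/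
def tensor : {n : ℕ} → (Fin n → OneParticle) → TensorPower n
  | 0, _ => memLp_one_zero.toLp _
  | n + 1, f => tensorLeft (f 0) n (tensor fun i => f i.succ)

theorem tensor_succ {n : ℕ} (f : Fin (n + 1) → OneParticle) :
    tensor f = tensorLeft (f 0) n (tensor fun i => f i.succ) := rfl

theorem coeFn_tensor {n : ℕ} (f : Fin n → OneParticle) :
    tensor f =ᵐ[tensorMeasure n] fun x => ∏ i, f i (x i) := by
  induction n with
  | zero => exact memLp_one_zero.coeFn_toLp.trans (Filter.Eventually.of_forall fun x => by simp)
  | succ n ih =>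
    filter_upwards [coeFn_tensorLeft (f 0) (tensor fun i => f i.succ),
      ae_tail (ih fun i => f i.succ)] with x h1 h2
    rw [tensor_succ, h1, h2, Fin.prod_univ_succ]

theorem inner_tensor_tensor {n : ℕ} (f f' : Fin n → OneParticle) :
    inner ℂ (tensor f) (tensor f') = ∏ i, inner ℂ (f i) (f' i) := by
  induction n with
  | zero =>
    have h : (tensorMeasure 0) Set.univ = 1 := by
      rw [tensorMeasure, Measure.pi_of_empty]; simp
    rw [L2.inner_def, Finset.univ_eq_empty, Finset.prod_empty]
    have : (fun x => inner ℂ (tensor f x) (tensor f' x)) =ᵐ[tensorMeasure 0] fun _ => (1 : ℂ) := by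
      filter_upwards [coeFn_tensor f, coeFn_tensor f'] with x h1 h2
      rw [h1, h2]
      simp
    rw [integral_congr_ae this, integral_const, Measure.real, h]
    simp
  | succ n ih =>
    rw [tensor_succ, tensor_succ, inner_tensorLeft_tensorLeft, ih, Fin.prod_univ_succ]

/-! ### Products of creation operators on the vacuum -/

/-- The `n`-particle vector `√(n!) P⁽ⁿ⁾ (f₁ ⊗ ⋯ ⊗ fₙ)`. -/
def productVector (g η : ℝ) {n : ℕ} (f : Fin n → OneParticle) : nParticle g η n :=
  (√(n.factorial : ℝ) : ℂ) • projP g η n (tensor f)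

theorem productVector_zero (g η : ℝ) (f : Fin 0 → OneParticle) :
    productVector g η f = vacuumZero g η := by
  rw [productVector, Nat.factorial_zero, Nat.cast_one, Real.sqrt_one, Complex.ofReal_one, one_smul]
  exact Submodule.orthogonalProjectionOnto_mem_subspace_eq_self (vacuumZero g η)

theorem creationLevel_productVector (g η : ℝ) {n : ℕ} (f : Fin (n + 1) → OneParticle) :
    creationLevel g η (f 0) n (productVector g η fun i => f i.succ) = productVector g η f := by
  rw [productVector, map_smul, productVector, tensor_succ, ← projP_tensorLeft_projP,
    Nat.factorial_succ, Nat.cast_mul, Real.sqrt_mul (by positivity), Complex.ofReal_mul,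
    mul_comm, mul_smul]
  push_cast
  rfl

theorem coe_creation_of_eq_single {g η : ℝ} (f : OneParticle) {n : ℕ} {φ : finiteParticle g η}
    {v : nParticle g η n}
    (hφ : (φ : Fock g η) = lp.single (E := fun n : ℕ => nParticle g η n) 2 n v) :
    (creation g η f φ : Fock g η) =
      lp.single (E := fun n : ℕ => nParticle g η n) 2 (n + 1) (creationLevel g η f n v) := by
  refine lp.ext (funext fun k => ?_)
  change creationSeq g η f φ k = _
  rw [hφ]
  cases k with
  | zero => rw [lp.single_apply_ne _ _ _ (Nat.succ_ne_zero n).symm]; rfl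
  | succ k =>
    rw [creationSeq]
    by_cases h : k = n
    · subst h
      rw [lp.single_apply_self, lp.single_apply_self]
    · rw [lp.single_apply_ne _ _ _ h, lp.single_apply_ne _ _ _ (by simpa using h), map_zero]

theorem coe_prod_creation_vacuum (g η : ℝ) {n : ℕ} (f : Fin n → OneParticle) :
    (((List.ofFn fun i => creation g η (f i)).prod (vacuum g η) : finiteParticle g η) : Fock g η) =
      lp.single (E := fun n : ℕ => nParticle g η n) 2 n (productVector g η f) := by
  induction n with
  | zero =>
    rw [productVector_zero]
    rfl
  | succ n ih =>
    rw [List.ofFn_succ, List.prod_cons, Module.End.mul_apply,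
      coe_creation_of_eq_single _ (ih fun i => f i.succ), creationLevel_productVector]

/-! ### Totality of products of test functions -/

theorem coeFn_component (α : Side) {Ω : TopologicalSpace.Opens ℝ}
    (h : TestFunction Ω ℂ (⊤ : ℕ∞)) :
    component α h =ᵐ[labelMeasure] fun x => if x.1 = α then h x.2 else 0 :=
  (memLp_component α h).coeFn_toLp

theorem measurePreserving_prodMk (α : Side) :
    MeasurePreserving (Prod.mk α) (volume : Measure ℝ)
      (labelMeasure.restrict ({α} ×ˢ Set.univ)) := by
  refine ⟨measurable_prodMk_left, ?_⟩
  rw [labelMeasure, ← Measure.prod_restrict, Measure.restrict_singleton, Measure.restrict_univ,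
    Measure.count_singleton, one_smul, Measure.dirac_prod]

theorem inner_component (α : Side) {Ω : TopologicalSpace.Opens ℝ}
    (h : TestFunction Ω ℂ (⊤ : ℕ∞)) (ψ : OneParticle) :
    inner ℂ (component α h) ψ = ∫ p, inner ℂ (h p) (ψ (α, p)) := by
  have h1 : inner ℂ (component α h) ψ =
      ∫ y, ({α} ×ˢ Set.univ : Set Label).indicator (fun y => inner ℂ (h y.2) (ψ y)) y
        ∂labelMeasure := by
    rw [L2.inner_def]
    refine integral_congr_ae ?_
    filter_upwards [coeFn_component α h] with y hy
    rw [hy]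
    by_cases hα : y.1 = α <;> simp [Set.indicator, hα]
  rw [h1, integral_indicator ((measurableSet_singleton α).prod MeasurableSet.univ),
    ← (measurePreserving_prodMk α).integral_comp (measurableEmbedding_prodMk_left α)]

/-- The fundamental lemma of the calculus of variations on the copy of $\mathbb R$ labelled by
$\alpha$; real test functions, cast to complex ones, suffice. -/
theorem ae_eq_zero_of_inner_component_eq_zero (α : Side) (V : TopologicalSpace.Opens ℝ)
    {ψ : OneParticle}
    (hψ : ∀ h : TestFunction V ℂ (⊤ : ℕ∞), inner ℂ (component α h) ψ = 0) :
    ∀ᵐ y ∂labelMeasure, y ∈ ({α} ×ˢ (V : Set ℝ) : Set Label) → ψ y = 0 := by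
  have hmp := measurePreserving_prodMk α
  have hmem : MemLp (fun p => ψ (α, p)) 2 volume :=
    ((Lp.memLp ψ).restrict _).comp_measurePreserving hmp
  have h1 : ∀ᵐ p : ℝ, p ∈ (V : Set ℝ) → ψ (α, p) = 0 := by
    refine V.isOpen.ae_eq_zero_of_integral_contDiff_smul_eq_zero
      ((hmem.locallyIntegrable (by norm_num)).locallyIntegrableOn _) fun G h1 h2 h3 => ?_
    have hsupp : Function.support (fun p => (G p : ℂ)) = Function.support G := by
      ext p; simp
    let T : TestFunction V ℂ (⊤ : ℕ∞) :=
      { toFun := fun p => (G p : ℂ)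
        contDiff' := Complex.ofRealCLM.contDiff.comp h1
        hasCompactSupport' := h2.comp_left Complex.ofReal_zero
        tsupport_subset' := by rw [tsupport, hsupp]; exact h3 }
    rw [← hψ T, inner_component]
    refine integral_congr_ae (Filter.Eventually.of_forall fun p => ?_)
    change G p • ψ (α, p) = inner ℂ (G p : ℂ) (ψ (α, p))
    rw [RCLike.inner_apply, Complex.conj_ofReal, Complex.real_smul, mul_comm]
  have h2 : ∀ᵐ y ∂(labelMeasure.restrict ({α} ×ˢ Set.univ)), y.2 ∈ (V : Set ℝ) → ψ y = 0 := by
    rw [← hmp.map_eq]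
    exact (measurableEmbedding_prodMk_left α).ae_map_iff.2 h1
  rw [ae_restrict_iff' ((measurableSet_singleton α).prod MeasurableSet.univ)] at h2
  filter_upwards [h2] with y hy hmem
  exact hy ⟨hmem.1, trivial⟩ hmem.2

/-- The condition `hf` says by double orthogonality that $f_i$ lies in the closed span of $D_i$. The
factors are replaced one at a time, the adjoints of $f\mapsto f\otimes\varphi$ and $\varphi\mapsto
f\otimes\varphi$ reducing each replacement to a smaller tensor power. -/
theorem inner_tensor_eq_zero {n : ℕ} {D : Fin n → Set OneParticle} {φ : TensorPower n}
    (hφ : ∀ f : Fin n → OneParticle, (∀ i, f i ∈ D i) → inner ℂ (tensor f) φ = 0)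
    (f : Fin n → OneParticle)
    (hf : ∀ i (ψ : OneParticle), (∀ d ∈ D i, inner ℂ d ψ = 0) → inner ℂ (f i) ψ = 0) :
    inner ℂ (tensor f) φ = 0 := by
  induction n with
  | zero => exact hφ f fun i => i.elim0
  | succ n ih =>
    have h1 : inner ℂ (f 0) ((tensorRightL (tensor fun i => f i.succ)).adjoint φ) = 0 := by
      refine hf 0 _ fun d hd => ?_
      rw [ContinuousLinearMap.adjoint_inner_right]
      change inner ℂ (tensorLeftL d n (tensor fun i => f i.succ)) φ = 0
      rw [← ContinuousLinearMap.adjoint_inner_right]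
      refine ih (D := fun i => D i.succ) (fun f' hf' => ?_) _ fun i => hf i.succ
      rw [ContinuousLinearMap.adjoint_inner_right]
      exact hφ (Fin.cons d f') fun i => Fin.cases hd hf' i
    rw [ContinuousLinearMap.adjoint_inner_right] at h1
    exact h1

/-- This integral is the inner product of $\varphi$ with a tensor product of indicators, each of
which `hD` places in the closed span of $D_i$. -/
theorem setIntegral_pi_eq_zero {n : ℕ} {A : Fin n → Set Label}
    (hfin : ∀ i, labelMeasure (A i) ≠ ∞) {D : Fin n → Set OneParticle}
    (hD : ∀ i (ψ : OneParticle), (∀ d ∈ D i, inner ℂ d ψ = 0) →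
      ∀ᵐ y ∂labelMeasure, y ∈ A i → ψ y = 0) {φ : TensorPower n}
    (hφ : ∀ f : Fin n → OneParticle, (∀ i, f i ∈ D i) → inner ℂ (tensor f) φ = 0)
    {B : Fin n → Set Label} (hB : ∀ i, MeasurableSet (B i)) (hBA : ∀ i, B i ⊆ A i) :
    ∫ x in Set.univ.pi B, φ x ∂(tensorMeasure n) = 0 := by
  have hBfin : ∀ i, labelMeasure (B i) ≠ ∞ := fun i =>
    ((measure_mono (hBA i)).trans_lt (hfin i).lt_top).ne
  have hm : MeasurableSet (Set.univ.pi B) := MeasurableSet.univ_pi hB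
  have hmfin : tensorMeasure n (Set.univ.pi B) ≠ ∞ := by
    rw [tensorMeasure, Measure.pi_pi]
    exact ENNReal.prod_ne_top fun i _ => hBfin i
  have ht : tensor (fun i => indicatorConstLp 2 (hB i) (hBfin i) (1 : ℂ)) =
      indicatorConstLp 2 hm hmfin (1 : ℂ) := by
    refine Lp.ext ?_
    have h2 : ∀ᵐ x ∂(tensorMeasure n), ∀ i, indicatorConstLp 2 (hB i) (hBfin i) (1 : ℂ) (x i) =
        (B i).indicator (fun _ => (1 : ℂ)) (x i) := by
      rw [ae_all_iff]
      exact fun i => (quasiMeasurePreserving_eval i).ae indicatorConstLp_coeFn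
    filter_upwards [coeFn_tensor fun i => indicatorConstLp 2 (hB i) (hBfin i) (1 : ℂ), h2,
      indicatorConstLp_coeFn (p := 2) (hs := hm) (hμs := hmfin) (c := (1 : ℂ))] with x a b c
    rw [a, c, Finset.prod_congr rfl fun i _ => b i]
    by_cases hx : x ∈ Set.univ.pi B
    · rw [Set.indicator_of_mem hx]
      exact Finset.prod_eq_one fun i _ => Set.indicator_of_mem (hx i trivial) _
    · rw [Set.indicator_of_notMem hx]
      simp only [Set.mem_univ_pi, not_forall] at hx
      obtain ⟨i, hi⟩ := hx
      exact Finset.prod_eq_zero (Finset.mem_univ i) (Set.indicator_of_notMem hi _)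
  rw [← L2.inner_indicatorConstLp_one hm hmfin, ← ht]
  refine inner_tensor_eq_zero hφ _ fun i ψ hψ => ?_
  rw [L2.inner_indicatorConstLp_one]
  refine setIntegral_eq_zero_of_ae_eq_zero ?_
  filter_upwards [hD i ψ hψ] with y hy hyB
  exact hy (hBA i hyB)

/-- Rectangles form a π-system generating the product σ-algebra. Finite measure makes $\varphi$
integrable, so vanishing integrals over rectangles pass to all measurable sets. -/
theorem ae_eq_zero_of_inner_tensor_eq_zero {n : ℕ} {A : Fin n → Set Label}
    (hA : ∀ i, MeasurableSet (A i)) (hfin : ∀ i, labelMeasure (A i) ≠ ∞)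
    {D : Fin n → Set OneParticle}
    (hD : ∀ i (ψ : OneParticle), (∀ d ∈ D i, inner ℂ d ψ = 0) →
      ∀ᵐ y ∂labelMeasure, y ∈ A i → ψ y = 0) {φ : TensorPower n}
    (hφ : ∀ f : Fin n → OneParticle, (∀ i, f i ∈ D i) → inner ℂ (tensor f) φ = 0) :
    ∀ᵐ x ∂(tensorMeasure n), x ∈ Set.univ.pi A → φ x = 0 := by
  have hm : MeasurableSet (Set.univ.pi A) := MeasurableSet.univ_pi hA
  have hmfin : tensorMeasure n (Set.univ.pi A) ≠ ∞ := by
    rw [tensorMeasure, Measure.pi_pi]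
    exact ENNReal.prod_ne_top fun i _ => hfin i
  have : IsFiniteMeasure ((tensorMeasure n).restrict (Set.univ.pi A)) :=
    isFiniteMeasure_restrict.2 hmfin
  have hint : Integrable φ ((tensorMeasure n).restrict (Set.univ.pi A)) :=
    ((Lp.memLp φ).restrict _).integrable (by norm_num)
  have hrect : ∀ B : Fin n → Set Label, (∀ i, MeasurableSet (B i)) →
      ∫ x in Set.univ.pi B, φ x ∂((tensorMeasure n).restrict (Set.univ.pi A)) = 0 := by
    intro B hB
    rw [Measure.restrict_restrict (MeasurableSet.univ_pi hB), ← Set.pi_inter_distrib]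
    exact setIntegral_pi_eq_zero hfin hD hφ (fun i => (hB i).inter (hA i))
      fun i => Set.inter_subset_right
  rw [← ae_restrict_iff' hm]
  refine hint.ae_eq_zero_of_forall_setIntegral_eq_zero fun s hs _ => ?_
  refine MeasurableSpace.induction_on_inter
    (C := fun s _ => ∫ x in s, φ x ∂((tensorMeasure n).restrict (Set.univ.pi A)) = 0)
    generateFrom_pi.symm isPiSystem_pi (by simp) ?_ (fun t ht ih => ?_)
    (fun f hd hf ih => ?_) s hs
  · rintro _ ⟨B, hB, rfl⟩
    exact hrect B fun i => hB i trivial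
  · have h1 := integral_add_compl ht hint
    have h2 := hrect (fun _ => Set.univ) fun _ => MeasurableSet.univ
    rw [Set.pi_univ, setIntegral_univ] at h2
    rwa [ih, zero_add, h2] at h1
  · rw [integral_iUnion hf hd hint.integrableOn]
    simp [ih]

/-! ### Boxes in a chamber -/

/-- The interval of radius `δ` around the momentum of a label. -/
def interval (y : Label) (δ : ℝ) : TopologicalSpace.Opens ℝ :=
  ⟨Metric.ball y.2 δ, Metric.isOpen_ball⟩

/-- The points with the same signs as `x` and with momenta in the intervals of radius `δ` around
those of `x`. -/
def box {n : ℕ} (x : Fin n → Label) (δ : ℝ) : Set (Fin n → Label) :=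
  Set.univ.pi fun i => {(x i).1} ×ˢ (interval (x i) δ : Set ℝ)

/-- For fixed signs the chamber conditions are open in the momenta, and balls of the supremum metric
are products of intervals. -/
theorem exists_box_subset_chamber {ε : Side} {n : ℕ} {x : Fin n → Label} (hx : x ∈ chamber ε n) :
    ∃ δ > 0, box x δ ⊆ chamber ε n := by
  have hopen : IsOpen {p : Fin n → ℝ | (∀ i, 0 < sgn ε * (sgn (x i).1 * p i)) ∧
      ∀ i j, i < j → sgn (x j).1 * p j < sgn (x i).1 * p i} := by
    simp only [Set.ofPred_and, Set.ofPred_forall]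
    refine IsOpen.inter ?_ ?_
    · exact isOpen_iInter_of_finite fun i => isOpen_lt continuous_const (by fun_prop)
    · exact isOpen_iInter_of_finite fun i => isOpen_iInter_of_finite fun j =>
        isOpen_iInter_of_finite fun _ => isOpen_lt (by fun_prop) (by fun_prop)
  obtain ⟨δ, hδ, hball⟩ := Metric.isOpen_iff.1 hopen (fun i => (x i).2) hx
  refine ⟨δ, hδ, fun y hy => ?_⟩
  have h := hball (a := fun i => (y i).2) ((dist_pi_lt_iff hδ).2 fun i => (hy i trivial).2)
  have he : (fun i => ((x i).1, (y i).2)) = y := by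
    ext1 i
    exact Prod.ext (hy i trivial).1.symm rfl
  change (fun i => ((x i).1, (y i).2)) ∈ chamber ε n at h
  rwa [he] at h

theorem mem_box_self {n : ℕ} (x : Fin n → Label) {δ : ℝ} (hδ : 0 < δ) : x ∈ box x δ :=
  fun _ _ => ⟨rfl, Metric.mem_ball_self hδ⟩

theorem update_mem_box {n : ℕ} {x y : Fin n → Label} {δ : ℝ} (hy : y ∈ box x δ) (i : Fin n)
    {p : ℝ} (hp : p ∈ interval (x i) δ) : Function.update y i ((x i).1, p) ∈ box x δ := by
  intro j _
  by_cases h : j = i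
  · subst h
    rw [Function.update_self]
    exact ⟨rfl, hp⟩
  · rw [Function.update_of_ne h]
    exact hy j trivial

theorem ae_eq_zero_on_chamber {ε : Side} {n : ℕ} {φ : TensorPower n}
    (hφ : ∀ (x : Fin n → Label) (δ : ℝ), 0 < δ → box x δ ⊆ chamber ε n →
      ∀ h : ∀ i, TestFunction (interval (x i) δ) ℂ (⊤ : ℕ∞),
        inner ℂ (tensor fun i => component (x i).1 (h i)) φ = 0) :
    ∀ᵐ x ∂(tensorMeasure n), x ∈ chamber ε n → φ x = 0 := by
  have hnull : tensorMeasure n {x | x ∈ chamber ε n ∧ φ x ≠ 0} = 0 := by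
    refine measure_null_of_locally_null _ fun x hx => ?_
    obtain ⟨δ, hδ, hbox⟩ := exists_box_subset_chamber hx.1
    have hae : ∀ᵐ y ∂(tensorMeasure n), y ∈ box x δ → φ y = 0 := by
      refine ae_eq_zero_of_inner_tensor_eq_zero
        (D := fun i => Set.range fun h : TestFunction (interval (x i) δ) ℂ (⊤ : ℕ∞) =>
          component (x i).1 h)
        (fun i => (measurableSet_singleton _).prod (interval (x i) δ).isOpen.measurableSet)
        (fun i => ?_) (fun i ψ hψ => ?_) fun f hf => ?_
      · rw [labelMeasure, Measure.prod_prod, Measure.count_singleton, one_mul]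
        exact measure_ball_lt_top.ne
      · exact ae_eq_zero_of_inner_component_eq_zero _ _ fun h => hψ _ ⟨h, rfl⟩
      · choose h hh using hf
        have : f = fun i => component (x i).1 (h i) := funext fun i => (hh i).symm
        rw [this]
        exact hφ x δ hδ hbox h
    refine ⟨{y | y ∈ box x δ ∧ φ y ≠ 0}, ?_, ?_⟩
    · have hnhds : box x δ ∈ nhds x := by
        refine IsOpen.mem_nhds (isOpen_set_pi Set.finite_univ fun i _ => ?_) (mem_box_self x hδ)
        exact (isOpen_discrete _).prod (interval (x i) δ).isOpen
      filter_upwards [self_mem_nhdsWithin, mem_nhdsWithin_of_mem_nhds hnhds] with y h1 h2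
      exact ⟨h2, h1.2⟩
    · rw [ae_iff] at hae
      simpa using hae
  rw [ae_iff]
  simpa using hnull

/-! ### Unitary maps between total families with the same Gram matrix -/

section Gram

variable {ι H : Type*} [NormedAddCommGroup H] [InnerProductSpace ℂ H]

theorem eq_of_eqOn_dense {p : Submodule ℂ H} (hp : Dense (p : Set H)) {A B : H →L[ℂ] H}
    (h : ∀ v : p, A v = B v) : A = B :=
  ContinuousLinearMap.coeFn_injective (Continuous.ext_on hp A.continuous B.continuous
    fun v hv => h ⟨v, hv⟩)

theorem linearMap_ext_of_eq_span_range {K : Type*} [AddCommGroup K] [Module ℂ K] {v : ι → H}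
    {p : Submodule ℂ H} (hp : p = Submodule.span ℂ (Set.range v)) {S S' : p →ₗ[ℂ] K}
    (h : ∀ i (hi : v i ∈ p), S ⟨v i, hi⟩ = S' ⟨v i, hi⟩) : S = S' := by
  subst hp
  refine LinearMap.ext fun x => ?_
  obtain ⟨x, hx⟩ := x
  induction hx using Submodule.span_induction with
  | mem x hx =>
    obtain ⟨i, rfl⟩ := hx
    exact h i _
  | zero => exact (map_zero S).trans (map_zero S').symm
  | add x y hx hy ihx ihy =>
    exact (map_add S ⟨x, hx⟩ ⟨y, hy⟩).trans
      ((congrArg₂ _ ihx ihy).trans (map_add S' ⟨x, hx⟩ ⟨y, hy⟩).symm)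
  | smul c x hx ih =>
    exact (map_smul S c ⟨x, hx⟩).trans ((congrArg _ ih).trans (map_smul S' c ⟨x, hx⟩).symm)

variable [CompleteSpace H]

theorem dense_span_range_of_forall_inner_eq_zero {v : ι → H}
    (hv : ∀ x, (∀ i, inner ℂ (v i) x = 0) → x = 0) :
    Dense (Submodule.span ℂ (Set.range v) : Set H) := by
  rw [Submodule.dense_iff_topologicalClosure_eq_top, Submodule.topologicalClosure_eq_top_iff,
    Submodule.eq_bot_iff]
  exact fun x hx => hv x fun i =>
    (Submodule.mem_orthogonal _ x).1 hx _ (Submodule.subset_span ⟨i, rfl⟩)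

/-- Equal Gram matrices give equal norms for linear combinations with the same coefficients. The
identity on finitely supported coefficients then descends to an isometry between dense subspaces and
extends. -/
theorem exists_linearIsometryEquiv_of_inner_eq {v w : ι → H}
    (hgram : ∀ i j, inner ℂ (v i) (v j) = inner ℂ (w i) (w j))
    (hv : Dense (Submodule.span ℂ (Set.range v) : Set H))
    (hw : Dense (Submodule.span ℂ (Set.range w) : Set H)) :
    ∃ U : H ≃ₗᵢ[ℂ] H, ∀ i, U (v i) = w i := by
  have hrange : ∀ u : ι → H, Dense (Submodule.span ℂ (Set.range u) : Set H) →
      DenseRange (Finsupp.linearCombination ℂ u) := fun u hu => by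
    rwa [DenseRange, ← LinearMap.coe_range, Finsupp.range_linearCombination]
  have hinner : ∀ c d : ι →₀ ℂ,
      inner ℂ (Finsupp.linearCombination ℂ w c) (Finsupp.linearCombination ℂ w d) =
        inner ℂ (Finsupp.linearCombination ℂ v c) (Finsupp.linearCombination ℂ v d) := fun c d => by
    simp only [Finsupp.linearCombination_apply, Finsupp.sum_inner, Finsupp.inner_sum,
      inner_smul_left, inner_smul_right, hgram]
  have hnorm : ∀ c : ι →₀ ℂ, ‖Finsupp.linearCombination ℂ w (LinearEquiv.refl ℂ (ι →₀ ℂ) c)‖ =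
      ‖Finsupp.linearCombination ℂ v c‖ := fun c => by
    rw [LinearEquiv.refl_apply, norm_eq_sqrt_re_inner (𝕜 := ℂ), hinner, ← norm_eq_sqrt_re_inner]
  refine ⟨(LinearEquiv.refl ℂ (ι →₀ ℂ)).extendOfIsometry _ _ (hrange v hv) (hrange w hw) hnorm,
    fun i => ?_⟩
  have := LinearEquiv.extendOfIsometry_eq (LinearEquiv.refl ℂ (ι →₀ ℂ)) _ _ (hrange v hv)
    (hrange w hw) hnorm (Finsupp.single i 1)
  simpa using this

/-- The restriction of a unitary operator to a dense subspace, and its unique unitary extension. -/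
theorem exists_linearEquiv_unitary {p q : Submodule ℂ H} (hp : Dense (p : Set H))
    (hq : Dense (q : Set H)) (W : H ≃ₗᵢ[ℂ] H)
    (hW : p.map (W.toLinearEquiv : H →ₗ[ℂ] H) = q) :
    ∃ S : p ≃ₗ[ℂ] q, (∀ v, (S v : H) = W v) ∧ ∃ U V : unitary (H →L[ℂ] H),
      (∀ v : p, U.1 v = S v) ∧ (∀ w : q, V.1 w = S.symm w) ∧ V = U⁻¹ ∧
      (∀ B : H →L[ℂ] H, (∀ v : p, B v = S v) → B = U) ∧
      ∀ B : H →L[ℂ] H, (∀ w : q, B w = S.symm w) → B = V := by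
  let S : p ≃ₗ[ℂ] q := (W.toLinearEquiv.submoduleMap p).trans (LinearEquiv.ofEq _ _ hW)
  let U : unitary (H →L[ℂ] H) := Unitary.linearIsometryEquiv.symm W
  have hU : ∀ v : p, U.1 v = S v := fun v => rfl
  have hV : ∀ w : q, (U⁻¹).1 w = S.symm w := fun w => by
    have h1 : (w : H) = U.1 (S.symm w) := by rw [hU, LinearEquiv.apply_symm_apply]
    have h2 : (U⁻¹).1 * U.1 = 1 := congrArg Subtype.val (inv_mul_cancel U)
    rw [h1]
    exact congrArg (fun A : H →L[ℂ] H => A (S.symm w)) h2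
  exact ⟨S, fun v => rfl, U, U⁻¹, hU, hV, rfl,
    fun B hB => eq_of_eqOn_dense hp fun v => (hB v).trans (hU v).symm,
    fun B hB => eq_of_eqOn_dense hq fun w => (hB w).trans (hV w).symm⟩

end Gram

/-! ### The in and out families -/

theorem component_congr {α β : Side} {Ω Ω' : TopologicalSpace.Opens ℝ}
    {h : TestFunction Ω ℂ (⊤ : ℕ∞)} {h' : TestFunction Ω' ℂ (⊤ : ℕ∞)} (hα : α = β)
    (hh : ∀ p, h p = h' p) : component α h = component β h' := by
  subst hα
  exact MemLp.toLp_congr _ _ (Filter.Eventually.of_forall fun x => by simp only [hh])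

theorem inner_component_hat {α β : Side} (h : HalfLineTest α) (h' : HalfLineTest β) :
    inner ℂ (component α (hat h)) (component β (hat h')) =
      inner ℂ (component α h) (component β h') := by
  rw [L2.inner_def, L2.inner_def,
    ← integral_comp_involutive measurePreserving_flipMomentum flipMomentum_flipMomentum]
  refine integral_congr_ae ?_
  filter_upwards [measurePreserving_flipMomentum.quasiMeasurePreserving.ae
      (coeFn_component α (hat h)), measurePreserving_flipMomentum.quasiMeasurePreserving.ae
      (coeFn_component β (hat h')), coeFn_component α h, coeFn_component β h'] with y h1 h2 h3 h4
  have e1 : hat h (-y.2) = h y.2 := congrArg h (neg_neg y.2)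
  have e2 : hat h' (-y.2) = h' y.2 := congrArg h' (neg_neg y.2)
  rw [h1, h2, h3, h4]
  simp only [flipMomentum, e1, e2]

theorem abs_eq_sgn_mul {α : Side} {p : ℝ} (hp : 0 < sgn α * p) : |p| = sgn α * p := by
  cases α
  · simp only [sgn, Bool.false_eq_true, if_false, neg_mul, one_mul] at hp ⊢
    exact abs_of_neg (by linarith)
  · simp only [sgn, if_true, one_mul] at hp ⊢
    exact abs_of_pos hp

theorem sgn_not (α : Side) : sgn (!α) = -sgn α := by cases α <;> simp [sgn]

theorem ae_tensor_component_eq_zero {n : ℕ} (α : Fin n → Side)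
    {Ω : Fin n → TopologicalSpace.Opens ℝ}
    (h : ∀ i, TestFunction (Ω i) ℂ (⊤ : ℕ∞)) {C : Set (Fin n → Label)}
    (hC : ∀ x : Fin n → Label, (∀ i, (x i).1 = α i ∧ (x i).2 ∈ tsupport (h i)) → x ∈ C) :
    ∀ᵐ x ∂(tensorMeasure n), x ∉ C → tensor (fun i => component (α i) (h i)) x = 0 := by
  have hc : ∀ᵐ x ∂(tensorMeasure n), ∀ i, component (α i) (h i) (x i) =
      if (x i).1 = α i then h i (x i).2 else 0 := by
    rw [ae_all_iff]
    exact fun i => (quasiMeasurePreserving_eval i).ae (coeFn_component (α i) (h i))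
  filter_upwards [coeFn_tensor fun i => component (α i) (h i), hc] with x h1 h2 hx
  rw [h1]
  by_contra hne
  refine hx (hC x fun i => ?_)
  have := Finset.prod_ne_zero_iff.1 hne i (Finset.mem_univ i)
  rw [h2 i] at this
  by_cases hα : (x i).1 = α i
  · rw [if_pos hα] at this
    exact ⟨hα, subset_tsupport _ this⟩
  · rw [if_neg hα] at this
    exact absurd rfl this

/-- The one-particle vectors of an out family. -/
def OutFamily.vec {n : ℕ} (h : OutFamily n) (i : Fin n) : OneParticle :=
  component (h.side i) (h.fn i)

/-- The one-particle vectors of an in family. -/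
def InFamily.vec {n : ℕ} (f : InFamily n) (i : Fin n) : OneParticle :=
  component (f.side i) (f.fn i)

theorem OutFamily.state_eq (g η : ℝ) {n : ℕ} (h : OutFamily n) :
    h.state g η = lp.single (E := fun n : ℕ => nParticle g η n) 2 n (productVector g η h.vec) :=
  coe_prod_creation_vacuum g η h.vec

theorem InFamily.state_eq (g η : ℝ) {n : ℕ} (f : InFamily n) :
    f.state g η = lp.single (E := fun n : ℕ => nParticle g η n) 2 n (productVector g η f.vec) :=
  coe_prod_creation_vacuum g η f.vec

/-- On these supports the rapidity equals $|p|$, so decreasing moduli are decreasing rapidities. -/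
theorem OutFamily.ae_tensor_eq_zero {n : ℕ} (h : OutFamily n) :
    ∀ᵐ x ∂(tensorMeasure n), x ∉ chamber true n → tensor h.vec x = 0 := by
  refine ae_tensor_component_eq_zero h.side h.fn fun x hx => ?_
  have hpos : ∀ i, 0 < sgn (x i).1 * (x i).2 := fun i => by
    rw [(hx i).1]
    exact (h.fn i).tsupport_subset (hx i).2
  refine ⟨fun i => by simpa [sgn, rapidity] using hpos i, fun i j hij => ?_⟩
  have := h.ordered i j hij _ (hx i).2 _ (hx j).2
  rwa [abs_eq_sgn_mul (hpos i), abs_eq_sgn_mul (hpos j)] at this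

/-- Here the rapidity is $-|p|$, so the opposite ordering of the moduli again makes the rapidities
decrease. -/
theorem InFamily.ae_tensor_eq_zero {n : ℕ} (f : InFamily n) :
    ∀ᵐ x ∂(tensorMeasure n), x ∉ chamber false n → tensor f.vec x = 0 := by
  refine ae_tensor_component_eq_zero f.side f.fn fun x hx => ?_
  have hpos : ∀ i, 0 < sgn (!(x i).1) * (x i).2 := fun i => by
    rw [(hx i).1]
    exact (f.fn i).tsupport_subset (hx i).2
  refine ⟨fun i => ?_, fun i j hij => ?_⟩
  · have := hpos i
    rw [sgn_not] at this
    rwa [show sgn false = -1 from rfl, neg_one_mul, rapidity, ← neg_mul]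
  · have := f.ordered i j hij _ (hx j).2 _ (hx i).2
    rw [abs_eq_sgn_mul (hpos i), abs_eq_sgn_mul (hpos j), sgn_not, sgn_not] at this
    simp only [rapidity]
    linarith

/-! ### Gram matrices -/

theorem inner_productVector_left (g η : ℝ) {n : ℕ} (f : Fin n → OneParticle)
    (ψ : nParticle g η n) :
    inner ℂ (productVector g η f) ψ =
      starRingEnd ℂ (√(n.factorial : ℝ) : ℂ) * inner ℂ (projP g η n (tensor f)) ψ :=
  inner_smul_left (projP g η n (tensor f) : TensorPower n) (ψ : TensorPower n) _

theorem inner_productVector_right (g η : ℝ) {n : ℕ} (f : Fin n → OneParticle)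
    (ψ : nParticle g η n) :
    inner ℂ ψ (productVector g η f) =
      (√(n.factorial : ℝ) : ℂ) * inner ℂ ψ (projP g η n (tensor f)) :=
  inner_smul_right (ψ : TensorPower n) (projP g η n (tensor f) : TensorPower n) _

theorem inner_productVector (g η : ℝ) {ε : Side} {n : ℕ} {f f' : Fin n → OneParticle}
    (hf : ∀ᵐ x ∂(tensorMeasure n), x ∉ chamber ε n → tensor f x = 0)
    (hf' : ∀ᵐ x ∂(tensorMeasure n), x ∉ chamber ε n → tensor f' x = 0) :
    inner ℂ (productVector g η f) (productVector g η f') =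
      starRingEnd ℂ (√(n.factorial : ℝ) : ℂ) * ((√(n.factorial : ℝ) : ℂ) *
        ((2 ^ n * (n.factorial : ℂ))⁻¹ * ∏ i, inner ℂ (f i) (f' i))) := by
  rw [inner_productVector_left, inner_productVector_right,
    inner_projP_projP g η hf hf', inner_tensor_tensor]

/-- Each side lives in one chamber, and the constant of `inner_productVector` does not depend on
which. -/
theorem inner_hatReversed_state (g η : ℝ) {n m : ℕ} (h : OutFamily n) (h' : OutFamily m) :
    inner ℂ (h.state g η) (h'.state g η) =
      inner ℂ (h.hatReversed.state g η) (h'.hatReversed.state g η) := by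
  rw [OutFamily.state_eq, OutFamily.state_eq, InFamily.state_eq, InFamily.state_eq,
    lp.inner_single_left, lp.inner_single_left]
  by_cases hnm : n = m
  · subst hnm
    rw [lp.single_apply_self, lp.single_apply_self,
      inner_productVector g η h.ae_tensor_eq_zero h'.ae_tensor_eq_zero,
      inner_productVector g η h.hatReversed.ae_tensor_eq_zero h'.hatReversed.ae_tensor_eq_zero,
      -- Reversing the family only permutes the factors of the product.
      ← Equiv.prod_comp Fin.revPerm fun i => inner ℂ (h.vec i) (h'.vec i)]
    congr 3
    exact Finset.prod_congr rfl fun i _ => (inner_component_hat _ _).symm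
  · rw [lp.single_apply_ne _ _ _ hnm, lp.single_apply_ne _ _ _ hnm, inner_zero_right,
      inner_zero_right]

/-! ### Totality of the in and out states -/

theorem pos_of_box_subset_chamber {ε : Side} {n : ℕ} {x : Fin n → Label} {δ : ℝ} (hδ : 0 < δ)
    (hbox : box x δ ⊆ chamber ε n) (i : Fin n) {p : ℝ} (hp : p ∈ interval (x i) δ) :
    0 < sgn ε * (sgn (x i).1 * p) := by
  have := (hbox (update_mem_box (mem_box_self x hδ) i hp)).1 i
  rwa [Function.update_self] at this

theorem lt_of_box_subset_chamber {ε : Side} {n : ℕ} {x : Fin n → Label} {δ : ℝ} (hδ : 0 < δ)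
    (hbox : box x δ ⊆ chamber ε n) {i j : Fin n} (hij : i < j) {p q : ℝ}
    (hp : p ∈ interval (x i) δ) (hq : q ∈ interval (x j) δ) :
    sgn (x j).1 * q < sgn (x i).1 * p := by
  have := (hbox (update_mem_box (update_mem_box (mem_box_self x hδ) i hp) j hq)).2 i j hij
  rwa [Function.update_self, Function.update_of_ne hij.ne, Function.update_self] at this

/-- A test function on an open set, regarded as a test function on a larger open set. -/
def enlarge {Ω Ω' : TopologicalSpace.Opens ℝ} (hΩ : (Ω : Set ℝ) ⊆ Ω')
    (h : TestFunction Ω ℂ (⊤ : ℕ∞)) : TestFunction Ω' ℂ (⊤ : ℕ∞) where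
  toFun := h
  contDiff' := h.contDiff
  hasCompactSupport' := h.hasCompactSupport
  tsupport_subset' := h.tsupport_subset.trans hΩ

/-- The out family given by test functions supported in a box in the positive chamber. -/
def OutFamily.ofBox {n : ℕ} {x : Fin n → Label} {δ : ℝ} (hδ : 0 < δ)
    (hbox : box x δ ⊆ chamber true n) (h : ∀ i, TestFunction (interval (x i) δ) ℂ (⊤ : ℕ∞)) :
    OutFamily n where
  side i := (x i).1
  fn i := enlarge (fun p hp => by
    have := pos_of_box_subset_chamber hδ hbox i hp
    rw [show sgn true = 1 from rfl, one_mul] at this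
    exact this) (h i)
  ordered i j hij p hp q hq := by
    have hp' := (h i).tsupport_subset hp
    have hq' := (h j).tsupport_subset hq
    have h1 := pos_of_box_subset_chamber hδ hbox i hp'
    have h2 := pos_of_box_subset_chamber hδ hbox j hq'
    rw [show sgn true = 1 from rfl, one_mul] at h1 h2
    rw [abs_eq_sgn_mul h1, abs_eq_sgn_mul h2]
    exact lt_of_box_subset_chamber hδ hbox hij hp' hq'

/-- The in family given by test functions supported in a box in the negative chamber. -/
def InFamily.ofBox {n : ℕ} {x : Fin n → Label} {δ : ℝ} (hδ : 0 < δ)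
    (hbox : box x δ ⊆ chamber false n) (h : ∀ i, TestFunction (interval (x i) δ) ℂ (⊤ : ℕ∞)) :
    InFamily n where
  side i := (x i).1
  fn i := enlarge (fun p hp => by
    have := pos_of_box_subset_chamber hδ hbox i hp
    rw [show sgn false = -1 from rfl, neg_one_mul, ← neg_mul, ← sgn_not] at this
    exact this) (h i)
  ordered i j hij p hp q hq := by
    have hp' := (h j).tsupport_subset hp
    have hq' := (h i).tsupport_subset hq
    have h1 := pos_of_box_subset_chamber hδ hbox j hp'
    have h2 := pos_of_box_subset_chamber hδ hbox i hq'
    rw [show sgn false = -1 from rfl, neg_one_mul, ← neg_mul, ← sgn_not] at h1 h2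
    rw [abs_eq_sgn_mul h1, abs_eq_sgn_mul h2, sgn_not, sgn_not]
    have := lt_of_box_subset_chamber hδ hbox hij hq' hp'
    linarith

theorem eq_zero_of_inner_productVector_eq_zero (g η : ℝ) (ε : Side) {n : ℕ}
    {ψ : nParticle g η n}
    (hψ : ∀ (x : Fin n → Label) (δ : ℝ), 0 < δ → box x δ ⊆ chamber ε n →
      ∀ h : ∀ i, TestFunction (interval (x i) δ) ℂ (⊤ : ℕ∞),
        inner ℂ (productVector g η fun i => component (x i).1 (h i)) ψ = 0) : ψ = 0 := by
  refine Subtype.ext (eq_zero_of_ae_eq_zero_chamber g η ε ψ.2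
    (ae_eq_zero_on_chamber fun x δ hδ hbox h => ?_))
  have h1 := hψ x δ hδ hbox h
  rw [inner_productVector_left, inner_projP_left] at h1
  refine (mul_eq_zero.1 h1).resolve_left ?_
  simp [Nat.factorial_ne_zero]

theorem eq_zero_of_inner_outState_eq_zero (g η : ℝ) {ψ : Fock g η}
    (hψ : ∀ (n : ℕ) (h : OutFamily n), inner ℂ (h.state g η) ψ = 0) : ψ = 0 := by
  refine lp.ext (funext fun n => ?_)
  refine eq_zero_of_inner_productVector_eq_zero g η true fun x δ hδ hbox h => ?_
  have := hψ n (OutFamily.ofBox hδ hbox h)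
  rwa [OutFamily.state_eq, lp.inner_single_left] at this

theorem eq_zero_of_inner_inState_eq_zero (g η : ℝ) {ψ : Fock g η}
    (hψ : ∀ (n : ℕ) (f : InFamily n), inner ℂ (f.state g η) ψ = 0) : ψ = 0 := by
  refine lp.ext (funext fun n => ?_)
  refine eq_zero_of_inner_productVector_eq_zero g η false fun x δ hδ hbox h => ?_
  have := hψ n (InFamily.ofBox hδ hbox h)
  rwa [InFamily.state_eq, lp.inner_single_left] at this

/-- The out family whose reflected and reversed family is the given in family. -/
def InFamily.hatReversed {n : ℕ} (f : InFamily n) : OutFamily n where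
  side i := f.side i.rev
  -- `hat` lands on the half-line of `!!α`, which is only propositionally that of `α`; `enlarge`
  -- transports the function.
  fn i := enlarge (Ω := halfLine (!!(f.side i.rev)))
    (fun p hp => by rwa [Bool.not_not] at hp) (hat (f.fn i.rev))
  ordered i j hij x hx y hy := by
    have hx' : x ∈ Neg.neg ⁻¹' tsupport (f.fn i.rev) := by
      rw [← tsupport_comp_neg]; exact hx
    have hy' : y ∈ Neg.neg ⁻¹' tsupport (f.fn j.rev) := by
      rw [← tsupport_comp_neg]; exact hy
    simpa using f.ordered j.rev i.rev (Fin.rev_lt_rev.2 hij) (-x) hx' (-y) hy'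

/-- Stated for states rather than families, whose functions have types depending on the signs. -/
theorem InFamily.hatReversed_hatReversed_state (g η : ℝ) {n : ℕ} (f : InFamily n) :
    f.hatReversed.hatReversed.state g η = f.state g η := by
  rw [InFamily.state_eq, InFamily.state_eq]
  congr 2
  ext1 i
  refine component_congr (congrArg f.side (Fin.rev_rev i)) fun p => ?_
  change f.fn i.rev.rev (- -p) = f.fn i p
  rw [neg_neg]
  have : ∀ j, j = i → f.fn j p = f.fn i p := by rintro _ rfl; rfl
  exact this _ (Fin.rev_rev i)

/-- The unique out family with no members. -/
def OutFamily.empty : OutFamily 0 := ⟨Fin.elim0, fun i => i.elim0, fun i => i.elim0⟩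

theorem outSpace_eq_span_range (g η : ℝ) :
    outSpace g η = Submodule.span ℂ (Set.range fun a : Σ n, OutFamily n => a.2.state g η) := by
  unfold outSpace
  congr 1
  ext v
  constructor
  · rintro (rfl | ⟨n, h, rfl⟩)
    · exact ⟨⟨0, OutFamily.empty⟩, rfl⟩
    · exact ⟨⟨n, h⟩, rfl⟩
  · rintro ⟨⟨n, h⟩, rfl⟩
    exact Or.inr ⟨n, h, rfl⟩

/-- Indexing the in states by out families puts both total families over one index type, as the Gram
comparison requires. The vacuum is the state of the empty family. -/
theorem inSpace_eq_span_range (g η : ℝ) :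
    inSpace g η =
      Submodule.span ℂ (Set.range fun a : Σ n, OutFamily n => a.2.hatReversed.state g η) := by
  unfold inSpace
  congr 1
  ext v
  constructor
  · rintro (rfl | ⟨n, f, rfl⟩)
    · exact ⟨⟨0, OutFamily.empty⟩, rfl⟩
    · exact ⟨⟨n, f.hatReversed⟩, f.hatReversed_hatReversed_state g η⟩
  · rintro ⟨⟨n, h⟩, rfl⟩
    exact Or.inr ⟨n, h.hatReversed, rfl⟩

theorem dense_outSpace (g η : ℝ) : Dense (outSpace g η : Set (Fock g η)) := by
  rw [outSpace_eq_span_range]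
  exact dense_span_range_of_forall_inner_eq_zero fun ψ hψ =>
    eq_zero_of_inner_outState_eq_zero g η fun n h => hψ ⟨n, h⟩

theorem dense_inSpace (g η : ℝ) : Dense (inSpace g η : Set (Fock g η)) := by
  rw [inSpace_eq_span_range]
  refine dense_span_range_of_forall_inner_eq_zero fun ψ hψ =>
    eq_zero_of_inner_inState_eq_zero g η fun n f => ?_
  rw [← f.hatReversed_hatReversed_state]
  exact hψ ⟨n, f.hatReversed⟩

/-! ### The scattering operator -/

theorem exists_scattering_isometry (g η : ℝ) :
    ∃ U : Fock g η ≃ₗᵢ[ℂ] Fock g η,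
      ∀ (n : ℕ) (h : OutFamily n), U (h.state g η) = h.hatReversed.state g η := by
  obtain ⟨U, hU⟩ := exists_linearIsometryEquiv_of_inner_eq
    (v := fun a : Σ n, OutFamily n => a.2.state g η)
    (w := fun a : Σ n, OutFamily n => a.2.hatReversed.state g η)
    (fun a b => inner_hatReversed_state g η a.2 b.2)
    (by rw [← outSpace_eq_span_range]; exact dense_outSpace g η)
    (by rw [← inSpace_eq_span_range]; exact dense_inSpace g η)
  exact ⟨U, fun n h => hU ⟨n, h⟩⟩

theorem map_outSpace {g η : ℝ} {U : Fock g η ≃ₗᵢ[ℂ] Fock g η}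
    (hU : ∀ (n : ℕ) (h : OutFamily n), U (h.state g η) = h.hatReversed.state g η) :
    (outSpace g η).map (U.toLinearEquiv : Fock g η →ₗ[ℂ] Fock g η) = inSpace g η := by
  rw [outSpace_eq_span_range, inSpace_eq_span_range, Submodule.map_span, ← Set.range_comp]
  congr 2
  ext1 a
  exact hU a.1 a.2

theorem IsScattering.ext {g η : ℝ} {S S' : outSpace g η →ₗ[ℂ] inSpace g η} (hS : IsScattering S)
    (hS' : IsScattering S') : S = S' := by
  refine linearMap_ext_of_eq_span_range (outSpace_eq_span_range g η) fun a ha => Subtype.ext ?_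
  exact (hS.2 a.1 a.2 _ rfl).trans (hS'.2 a.1 a.2 _ rfl).symm

end ImpurityNLS

end

theorem mainTheorem5 (g η : ℝ) (hg : 0 ≤ g) (hη : 0 ≤ η) :
    ∃ S : ImpurityNLS.outSpace g η ≃ₗ[ℂ] ImpurityNLS.inSpace g η,
      ImpurityNLS.IsScattering S.toLinearMap ∧
      (∀ S' : ImpurityNLS.outSpace g η →ₗ[ℂ] ImpurityNLS.inSpace g η,
        ImpurityNLS.IsScattering S' → S' = S.toLinearMap) ∧
      ∃ U V : unitary (ImpurityNLS.Fock g η →L[ℂ] ImpurityNLS.Fock g η),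
        (∀ v : ImpurityNLS.outSpace g η, U.1 v = S v) ∧
        (∀ w : ImpurityNLS.inSpace g η, V.1 w = S.symm w) ∧
        V = U⁻¹ ∧
        (∀ B : ImpurityNLS.Fock g η →L[ℂ] ImpurityNLS.Fock g η,
          (∀ v : ImpurityNLS.outSpace g η, B v = S v) → B = U) ∧
        (∀ B : ImpurityNLS.Fock g η →L[ℂ] ImpurityNLS.Fock g η,
          (∀ w : ImpurityNLS.inSpace g η, B w = S.symm w) → B = V) := by
  refine (ImpurityNLS.exists_scattering_isometry g η).elim fun W hW => ?_
  refine (ImpurityNLS.exists_linearEquiv_unitary (ImpurityNLS.dense_outSpace g η)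
    (ImpurityNLS.dense_inSpace g η) W (ImpurityNLS.map_outSpace hW)).imp fun S hS => ?_
  have hSc : ImpurityNLS.IsScattering S.toLinearMap :=
    -- The vacuum condition is the case of the empty family.
    ⟨fun v hv => (hS.1 v).trans ((congrArg W hv).trans (hW 0 ImpurityNLS.OutFamily.empty)),
      fun n h v hv => (hS.1 v).trans ((congrArg W hv).trans (hW n h))⟩
  exact ⟨hSc, fun S' hS' => hS'.ext hSc, hS.2⟩
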